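/- Let $k\ge 3$, let $x_1<\dots<x_k$ be real numbers and let $p_1,\dots,p_k>0$ with $p_1+\dots+p_k=1$. In the stochastic sequential assignment problem with $M$ rounds, i.i.d. random variables $X_1,\dots,X_M$ with $\mathbb P[X_t=x_i]=p_i$ are observed one by one, and rewards $r_1<\dots<r_M$ are attached to the locations $1,\dots,M$. A policy is a sequence $J(1),\dots,J(M)$ of random, pairwise distinct locations such that $J(t)$ is $\sigma(X_1,\dots,X_t)$-measurable; it is optimal if it maximizes $\mathbb E\big[\sum_{t=1}^M X_t\, r_{J(t)}\big]$ among all policies. If $N\ge 1$ locations are still empty when a value $x_i$ is observed (that is, in round $t=M-N+1$), let $\ell_N(i)\in\{1,\dots,N\}$ be the position, among these $N$ empty locations listed in increasing order, of the location at which an optimal policy places $x_i$ (an arbitrary choice if there are ties). Let $f_i=\sum_{j\le i}p_j$ for $0\le i\le k$, let $d_1=0$, $d_k=1$, and for $2\le i\le k-1$ let $$d_i=\frac{\log\frac{1-f_i}{1-f_{i-1}}}{\log\frac{f_{i-1}(1-f_i)}{(1-f_{i-1})f_i}}.$$ Then for any optimal policy, almost surely, $$\ell_N(i)=N\,(d_i+o(1))\qquad\text{as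 } N\to\infty,\quad i=1,\dots,k,$$ where the $o(1)$ term depends only on $(x_j)_{j\le k}$, $(p_j)_{j\le k}$ and $i$ (not on $M$, the rewards or the optimal policy). Moreover, let $2\le i\le k-1$ and let $X_1,X_2,\dots$ be i.i.d. with the above distribution. For $y\in(f_{i-1},f_i)$ the limits $$I_i^-(y)=-\lim_{N\to\infty}\frac1N\log\mathbb P\Big[\sum_{t=1}^N\mathbf 1_{X_t<x_i}\ge yN\Big],\qquad I_i^+(y)=-\lim_{N\to\infty}\frac1N\log\mathbb P\Big[\sum_{t=1}^N\mathbf 1_{X_t>x_i}\ge(1-y)N\Big]$$ exist and equal $$I_i^-(y)=y\log y+(1-y)\log(1-y)-y\log f_{i-1}-(1-y)\log(1-f_{i-1}),$$ $$I_i^+(y)=y\log y+(1-y)\log(1-y)-y\log f_i-(1-y)\log(1-f_i),$$ and $d_i$ is the unique point $y\in(f_{i-1},f_i)$ with $I_i^-(y)=I_i^+(y)$. -/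

import Mathlib

open MeasureTheory ProbabilityTheory Filter Topology Finset

namespace SeqAssign

noncomputable section

/-- The discrete distribution giving mass `p i` to the point `x i`. -/
def discreteLaw {k : ℕ} (p x : Fin k → ℝ) : Measure ℝ :=
  ∑ i, ENNReal.ofReal (p i) • Measure.dirac (x i)

/-- `X` is a family of independent random variables, each with the distribution
`discreteLaw p x`. -/
structure IsIIDSample {k : ℕ} (p x : Fin k → ℝ) {ι Ω : Type*} [MeasurableSpace Ω]
    (X : ι → Ω → ℝ) (P : Measure Ω) : Prop where
  measurable : ∀ t, Measurable (X t)
  indep : iIndepFun X P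
  law : ∀ t, P.map (X t) = discreteLaw p x

/-- The σ-algebra generated by the values observed in the rounds up to and including `t`. -/
@[reducible] def history {M : ℕ} {Ω : Type*} (X : Fin M → Ω → ℝ) (t : Fin M) : MeasurableSpace Ω :=
  ⨆ s : Fin M, ⨆ _ : s ≤ t, MeasurableSpace.comap (X s) inferInstance

/-- A policy for `M` rounds and `M` locations: the value of round `t` is placed at location
`J t`, chosen from the values observed so far, and the locations chosen are distinct. Rounds
and locations are numbered from `0` to `M - 1`. -/
structure IsPolicy {M : ℕ} {Ω : Type*} (X : Fin M → Ω → ℝ) (J : Fin M → Ω → Fin M) : Prop where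
  adapted : ∀ t, Measurable[history X t] (J t)
  distinct : ∀ ω, Function.Injective fun t => J t ω

/-- The reward collected when the rewards of the locations are `r`. -/
def reward {M : ℕ} {Ω : Type*} (X : Fin M → Ω → ℝ) (r : Fin M → ℝ) (J : Fin M → Ω → Fin M)
    (ω : Ω) : ℝ :=
  ∑ t, X t ω * r (J t ω)

/-- A policy is optimal if it maximizes the expected reward among all policies. -/
def IsOptimal {M : ℕ} {Ω : Type*} [MeasurableSpace Ω] (P : Measure Ω) (X : Fin M → Ω → ℝ)
    (r : Fin M → ℝ) (J : Fin M → Ω → Fin M) : Prop :=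
  IsPolicy X J ∧
    ∀ J' : Fin M → Ω → Fin M, IsPolicy X J' → ∫ ω, reward X r J' ω ∂P ≤ ∫ ω, reward X r J ω ∂P

/-- The position (counted from `1`) of the location chosen in round `t` among the `M - t`
locations that are still empty before that round, in the order of increasing rewards. -/
def chosenPosition {M : ℕ} {Ω : Type*} (J : Fin M → Ω → Fin M) (t : Fin M) (ω : Ω) : ℕ :=
  #{n : Fin M | n ≤ J t ω ∧ ∀ s < t, J s ω ≠ n}

/-- The cumulative probability up to and including the index `i`. -/
def cumLE {k : ℕ} (p : Fin k → ℝ) (i : Fin k) : ℝ := ∑ j with j ≤ i, p j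

/-- The cumulative probability of the indices before `i`. -/
def cumLT {k : ℕ} (p : Fin k → ℝ) (i : Fin k) : ℝ := ∑ j with j < i, p j

/-- The asymptotic optimal location `d i` of the value with index `i`. -/
def limitLocation {k : ℕ} (p : Fin k → ℝ) (i : Fin k) : ℝ :=
  if (i : ℕ) = 0 then 0
  else if (i : ℕ) + 1 = k then 1
  else Real.log ((1 - cumLE p i) / (1 - cumLT p i)) /
    Real.log (cumLT p i * (1 - cumLE p i) / ((1 - cumLT p i) * cumLE p i))

/-- The large-deviation rate of the binomial distribution with success probability `q` at the
proportion `y`. -/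
def binomialRate (q y : ℝ) : ℝ :=
  y * Real.log y + (1 - y) * Real.log (1 - y) - y * Real.log q - (1 - y) * Real.log (1 - q)

end

end SeqAssign

/-! Everything reduces to a triangle of numbers `slotValue`, here V(N,n), with V(N+1,n+1) = E
clamp(X; V(N,n), V(N,n+1)) and boundary values min x for n = 0 and max x for n > N. With N empty
locations, placing z at position l is best exactly when V(N-1,l-1) ≤ z ≤ V(N-1,l), whatever the
increasing rewards (`bestValue_sub_placedValue_eq_zero_iff`). The expected reward of any policy is a
constant minus its expected regrets (`integral_reward`), and some policy has no regret, so an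
optimal one has none almost surely (`IsOptimal.slotValue_le`). The chosen position is therefore
where row N-1 of the triangle crosses x_i, and it remains to find the slope of this crossing.

Let a = f_{i-1} and f = f_i. Two exponential rates compete. The deficit (x_i - V(N,n))⁺ is at most a
constant times a binomial(N,a) upper tail at n, hence decays at least at rate I⁻. The truncated
excess w = min(V - x_i, x_{i+1} - x_i) satisfies w(N+1,n+1) ≥ f w(N,n) + (1-f) w(N,n+1), so once
positive above some slope it decays, above any larger slope, at most at rate I⁺
(`exp_rate_le_of_pos`). Where deficits decay faster than gains, positivity spreads to slightly
smaller slopes (`pos_of_exp_rate_le`). Hence the infimum of the slopes of eventual positivity cannot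
lie where I⁻ > I⁺ (`eventually_pos_of_rateGap_pos`). The difference I⁻ - I⁺ is affine and increasing
with zero d_i. Reflection x ↦ -x (`slotValue_rev`) gives the opposite bound; for the smallest and
the largest value there is no competition and a strict inequality suffices.

The large-deviation limits come from a Chernoff bound and a Stirling bound, both derived from the
one-step recursion of binomial tails. -/

namespace SeqAssign

/-! ### Binomial tails: Stirling lower bound, Chernoff upper bound, large-deviation limit. -/

section Binomial

theorem le_log_factorial (n : ℕ) : n * Real.log n - n ≤ Real.log (n.factorial) := by
  rcases Nat.eq_zero_or_pos n with rfl | hn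
  · simp
  have hn' : (0 : ℝ) < n := by exact_mod_cast hn
  have hf : (0 : ℝ) < n.factorial := by exact_mod_cast n.factorial_pos
  have h := Real.pow_div_factorial_le_exp _ hn'.le n
  have h2 := Real.log_le_log (by positivity) h
  rw [Real.log_exp, Real.log_div (by positivity) hf.ne', Real.log_pow] at h2
  linarith

theorem log_factorial_le (n : ℕ) :
    Real.log (n.factorial) ≤ n * Real.log n - n + 1 + 2 * Real.log (n + 1) := by
  induction n with
  | zero => simp
  | succ n ih =>
    have hf : (0 : ℝ) < n.factorial := by exact_mod_cast n.factorial_pos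
    rw [Nat.factorial_succ, Nat.cast_mul, Real.log_mul (by positivity) hf.ne']
    push_cast
    have h1 : (1 : ℝ) - (n + 1) / (n + 2) ≤ Real.log (n + 2) - Real.log (n + 1) := by
      have := Real.one_sub_inv_le_log_of_pos (show (0 : ℝ) < (n + 2) / (n + 1) by positivity)
      rw [Real.log_div (by positivity) (by positivity), inv_div] at this
      exact this
    have h2 : (n : ℝ) * (1 - n / (n + 1)) ≤ n * (Real.log (n + 1) - Real.log n) := by
      rcases Nat.eq_zero_or_pos n with rfl | hn
      · simp
      have hn' : (0 : ℝ) < n := by exact_mod_cast hn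
      have := Real.one_sub_inv_le_log_of_pos (show (0 : ℝ) < (n + 1) / n by positivity)
      rw [Real.log_div (by positivity) (by positivity), inv_div] at this
      gcongr
    -- The slack `2 * log (n + 1)` in the bound is what lets the crude inequality 1 - 1/u ≤ log u
    -- close the induction.
    have h3 : (1 : ℝ) ≤ n * (1 - n / (n + 1)) + 2 * (1 - (n + 1) / (n + 2)) := by
      have : (n : ℝ) * (1 - n / (n + 1)) + 2 * (1 - (n + 1) / (n + 2)) - 1
          = n / ((n + 1) * (n + 2)) := by
        field_simp
        ring
      have h4 : (0 : ℝ) ≤ n / ((n + 1) * (n + 2)) := by positivity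
      linarith
    have e : (n : ℝ) + 1 + 1 = n + 2 := by ring
    rw [e]
    nlinarith

theorem le_log_choose {N j : ℕ} (h : j ≤ N) :
    N * Real.log N - j * Real.log j - ((N - j : ℕ) : ℝ) * Real.log ((N - j : ℕ) : ℝ)
      - (2 + 4 * Real.log (N + 1)) ≤ Real.log (N.choose j) := by
  have hN : (0 : ℝ) < N.factorial := by exact_mod_cast N.factorial_pos
  have hj : (0 : ℝ) < j.factorial := by exact_mod_cast j.factorial_pos
  have hNj : (0 : ℝ) < (N - j).factorial := by exact_mod_cast (N - j).factorial_pos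
  rw [Nat.cast_choose ℝ h, Real.log_div hN.ne' (by positivity), Real.log_mul hj.ne' hNj.ne']
  have h1 := le_log_factorial N
  have h2 := log_factorial_le j
  have h3 := log_factorial_le (N - j)
  have h4 : Real.log ((j : ℝ) + 1) ≤ Real.log (N + 1) :=
    Real.log_le_log (by positivity) (by gcongr)
  have h5 : Real.log (((N - j : ℕ) : ℝ) + 1) ≤ Real.log (N + 1) :=
    Real.log_le_log (by positivity) (by gcongr; omega)
  have h6 : ((N - j : ℕ) : ℝ) = N - j := by push_cast [h]; ring
  linarith

theorem continuous_binomialRate (q : ℝ) : Continuous (binomialRate q) := by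
  unfold binomialRate
  have h1 := Real.continuous_mul_log
  have h2 : Continuous fun y : ℝ => (1 - y) * Real.log (1 - y) :=
    h1.comp (continuous_const.sub continuous_id)
  fun_prop

theorem tendsto_log_error_div :
    Tendsto (fun N : ℕ => (2 + 4 * Real.log ((N : ℝ) + 1)) / N) atTop (𝓝 0) := by
  have h1 : Tendsto (fun N : ℕ => Real.log ((N : ℝ) + 1) / ((N : ℝ) + 1)) atTop (𝓝 0) := by
    have := (Real.isLittleO_log_id_atTop.tendsto_div_nhds_zero).comp
      (tendsto_natCast_atTop_atTop (R := ℝ) |>.comp (tendsto_add_atTop_nat 1))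
    refine this.congr fun N => ?_
    simp
  have h2 : Tendsto (fun N : ℕ => (1 : ℝ) / N) atTop (𝓝 0) := tendsto_one_div_atTop_nhds_zero_nat
  have h3 : Tendsto (fun N : ℕ => 2 * ((1 : ℝ) / N)
      + 4 * (Real.log ((N : ℝ) + 1) / ((N : ℝ) + 1) * (1 + 1 / N))) atTop
      (𝓝 (2 * 0 + 4 * (0 * (1 + 0)))) :=
    (h2.const_mul 2).add ((h1.mul (h2.const_add 1)).const_mul 4)
  simp only [mul_zero, zero_mul, add_zero] at h3
  refine h3.congr' ?_
  filter_upwards [eventually_gt_atTop 0] with N hN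
  have : (0 : ℝ) < N := by exact_mod_cast hN
  field_simp

/-- A binomial probability near the proportion `y` decays at most with the rate
`binomialRate q y`. -/
theorem eventually_exp_le_choose {q y r : ℝ} (hq : q ∈ Set.Ioo (0 : ℝ) 1)
    (hr : binomialRate q y < r) {j : ℕ → ℕ} (hj : ∀ᶠ N in atTop, j N ≤ N)
    (hjy : Tendsto (fun N => (j N : ℝ) / N) atTop (𝓝 y)) :
    ∀ᶠ N : ℕ in atTop,
      Real.exp (-r * N) ≤ (N.choose (j N) : ℝ) * q ^ (j N) * (1 - q) ^ (N - j N) := by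
  have h1 : Tendsto (fun N : ℕ => binomialRate q ((j N : ℝ) / N)
      + (2 + 4 * Real.log ((N : ℝ) + 1)) / N) atTop (𝓝 (binomialRate q y + 0)) :=
    (((continuous_binomialRate q).tendsto y).comp hjy).add tendsto_log_error_div
  rw [add_zero] at h1
  filter_upwards [h1.eventually (gt_mem_nhds hr), hj, eventually_gt_atTop 0] with N h2 h3 hN
  have hN' : (0 : ℝ) < N := by exact_mod_cast hN
  have hq0 := hq.1
  have hq1 : 0 < 1 - q := by linarith [hq.2]
  have hC : (0 : ℝ) < N.choose (j N) := by exact_mod_cast Nat.choose_pos h3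
  rw [← Real.le_log_iff_exp_le (by positivity), Real.log_mul (by positivity) (by positivity),
    Real.log_mul (by positivity) (by positivity), Real.log_pow, Real.log_pow]
  have h4 := le_log_choose h3
  have e1 : ∀ m : ℕ, (m : ℝ) / N * Real.log ((m : ℝ) / N) * N
      = m * Real.log m - m * Real.log N := by
    intro m
    rcases Nat.eq_zero_or_pos m with rfl | hm
    · simp
    have hm' : (0 : ℝ) < m := by exact_mod_cast hm
    rw [Real.log_div hm'.ne' hN'.ne']
    field_simp
  have e2 : (1 : ℝ) - (j N : ℝ) / N = ((N - j N : ℕ) : ℝ) / N := by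
    push_cast [h3]
    field_simp
  have e3 : ((N - j N : ℕ) : ℝ) = N - j N := by push_cast [h3]; ring
  have e4 : binomialRate q ((j N : ℝ) / N) * N = j N * Real.log (j N)
      + ((N - j N : ℕ) : ℝ) * Real.log ((N - j N : ℕ) : ℝ) - N * Real.log N
      - j N * Real.log q - ((N - j N : ℕ) : ℝ) * Real.log (1 - q) := by
    have a1 := e1 (j N)
    have a2 := e1 (N - j N)
    have a3 : (j N : ℝ) / N * Real.log q * N = j N * Real.log q := by field_simp
    have a4 : ((N - j N : ℕ) : ℝ) / N * Real.log (1 - q) * N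
      = ((N - j N : ℕ) : ℝ) * Real.log (1 - q) := by field_simp
    unfold binomialRate
    rw [e2]
    rw [e3] at *
    linear_combination a1 + a2 - a3 - a4
  have h5 : (2 + 4 * Real.log ((N : ℝ) + 1)) / N * N = 2 + 4 * Real.log ((N : ℝ) + 1) := by
    field_simp
  have h6 := mul_lt_mul_of_pos_right h2 hN'
  rw [add_mul, h5, e4] at h6
  linarith

/-- The exponential tilt that is optimal for the proportion `y`. -/
noncomputable def tilt (q y : ℝ) : ℝ := q * (1 - y) / ((1 - q) * y)

theorem tilt_mem {q y : ℝ} (hq : 0 < q) (hqy : q < y) (hy : y < 1) :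
    tilt q y ∈ Set.Ioo (0 : ℝ) 1 := by
  unfold tilt
  have h1 : 0 < 1 - y := by linarith
  have h2 : 0 < 1 - q := by linarith
  have h3 : 0 < y := by linarith
  refine ⟨by positivity, ?_⟩
  rw [div_lt_one (by positivity)]
  nlinarith

/-- At the optimal tilt the exponent of the Chernoff bound is exactly the rate, so upper and lower
bounds match. -/
theorem log_tilt_eq {q y : ℝ} (hq : 0 < q) (hqy : q < y) (hy : y < 1) :
    Real.log (q / tilt q y + (1 - q)) + y * Real.log (tilt q y) = -binomialRate q y := by
  have h1 : 0 < 1 - y := by linarith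
  have h2 : 0 < 1 - q := by linarith
  have h3 : 0 < y := by linarith
  have e : q / tilt q y + (1 - q) = (1 - q) / (1 - y) := by
    unfold tilt
    field_simp
    ring
  rw [e, tilt, Real.log_div h2.ne' h1.ne', Real.log_div (by positivity) (by positivity),
    Real.log_mul hq.ne' h1.ne', Real.log_mul h2.ne' h3.ne', binomialRate]
  ring

theorem binomialRate_compl (q y : ℝ) : binomialRate (1 - q) (1 - y) = binomialRate q y := by
  unfold binomialRate
  simp only [sub_sub_cancel]
  ring

/-- Chernoff's bound without probability: with ρ = q/θ + 1 - q, the function C ρ^N θ^n solves the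
recursion with equality and dominates the boundary values; in column 0 this needs ρ ≥ 1. Only
inequalities on `w` are used, so the bound also applies to the deficits of the slot values. -/
theorem binomialTail_le {q θ : ℝ} (hq : q ∈ Set.Ioo (0 : ℝ) 1) (hθ : θ ∈ Set.Ioo (0 : ℝ) 1)
    {C : ℝ} (hC : 0 ≤ C) {w : ℕ → ℕ → ℝ} (h0 : ∀ N, w N 0 ≤ C) (h00 : ∀ n, w 0 (n + 1) ≤ 0)
    (hs : ∀ N n, w (N + 1) (n + 1) ≤ q * w N n + (1 - q) * w N (n + 1)) (N n : ℕ) :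
    w N n ≤ C * (q / θ + (1 - q)) ^ N * θ ^ n := by
  have hq0 := hq.1
  have hq1 : 0 < 1 - q := by linarith [hq.2]
  have hθ0 := hθ.1
  have hρ : 1 ≤ q / θ + (1 - q) := by
    have : q ≤ q / θ := by
      rw [le_div_iff₀ hθ0]
      nlinarith [hθ.2]
    linarith
  induction N generalizing n with
  | zero =>
    cases n with
    | zero => simpa using h0 0
    | succ n => exact (h00 n).trans (by positivity)
  | succ N ih =>
    cases n with
    | zero =>
      refine (h0 _).trans ?_
      rw [pow_zero, mul_one]
      exact le_mul_of_one_le_right hC (one_le_pow₀ hρ)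
    | succ n =>
      refine (hs N n).trans ?_
      have h1 := mul_le_mul_of_nonneg_left (ih n) hq0.le
      have h2 := mul_le_mul_of_nonneg_left (ih (n + 1)) hq1.le
      refine (add_le_add h1 h2).trans (le_of_eq ?_)
      rw [pow_succ, pow_succ]
      field_simp

/-- The point mass at j obeys Pascal's rule, which is the same recursion, with smaller boundary
values. -/
theorem choose_le_binomialTail {q : ℝ} (hq : q ∈ Set.Ioo (0 : ℝ) 1)
    {w : ℕ → ℕ → ℝ} (h0 : ∀ N, 1 ≤ w N 0) (h00 : ∀ N n, 0 ≤ w N n)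
    (hs : ∀ N n, q * w N n + (1 - q) * w N (n + 1) ≤ w (N + 1) (n + 1)) (N j : ℕ) :
    (N.choose j : ℝ) * q ^ j * (1 - q) ^ (N - j) ≤ w N j := by
  have hq0 := hq.1
  have hq1 : 0 < 1 - q := by linarith [hq.2]
  induction N generalizing j with
  | zero =>
    cases j with
    | zero => simpa using h0 0
    | succ n => simpa using h00 0 (n + 1)
  | succ N ih =>
    cases j with
    | zero =>
      refine le_trans ?_ (h0 _)
      simp only [Nat.choose_zero_right, Nat.cast_one, pow_zero, one_mul]
      exact pow_le_one₀ hq1.le (by linarith)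
    | succ j =>
      refine le_trans ?_ (hs N j)
      have h1 := mul_le_mul_of_nonneg_left (ih j) hq0.le
      have h2 := mul_le_mul_of_nonneg_left (ih (j + 1)) hq1.le
      refine le_trans (le_of_eq ?_) (add_le_add h1 h2)
      rw [Nat.choose_succ_succ]
      push_cast
      rcases Nat.lt_or_ge j N with h | h
      · have e : N - j = (N - (j + 1)) + 1 := by omega
        rw [e, pow_succ, pow_succ]
        ring
      · rw [Nat.choose_eq_zero_of_lt (by omega : N < j + 1)]
        have e : N - j = 0 := by omega
        rw [e]
        simp
        ring

theorem tendsto_ceil_mul_div (y : ℝ) (hy : 0 ≤ y) :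
    Tendsto (fun N : ℕ => (⌈y * N⌉₊ : ℝ) / N) atTop (𝓝 y) :=
  (tendsto_nat_ceil_mul_div_atTop hy).comp tendsto_natCast_atTop_atTop

/-- The large-deviation limit of binomial upper tails, the tails being given by their
recursion. -/
theorem tendsto_binomialTail {q y : ℝ} (hq : 0 < q) (hqy : q < y) (hy : y < 1)
    {w : ℕ → ℕ → ℝ} (h0 : ∀ N, w N 0 = 1) (h00 : ∀ n, w 0 (n + 1) = 0)
    (hn : ∀ N n, 0 ≤ w N n)
    (hs : ∀ N n, w (N + 1) (n + 1) = q * w N n + (1 - q) * w N (n + 1)) :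
    Tendsto (fun N : ℕ => -(1 / (N : ℝ) * Real.log (w N ⌈y * N⌉₊))) atTop
      (𝓝 (binomialRate q y)) := by
  have hq' : q ∈ Set.Ioo (0 : ℝ) 1 := ⟨hq, by linarith⟩
  have hθ := tilt_mem hq hqy hy
  have hθ0 := hθ.1
  have hy0 : 0 < y := by linarith
  have hle : ∀ N : ℕ, ⌈y * N⌉₊ ≤ N := fun N => by
    rw [Nat.ceil_le]
    nlinarith [(Nat.cast_nonneg N : (0 : ℝ) ≤ N)]
  have hlow : ∀ N j : ℕ, _ := choose_le_binomialTail hq' (fun N => (h0 N).ge) hn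
    (fun N n => (hs N n).ge)
  have hup : ∀ N n : ℕ, _ := binomialTail_le hq' hθ zero_le_one (fun N => (h0 N).le)
    (fun n => (h00 n).le) (fun N n => (hs N n).le)
  have hq1 : 0 < 1 - q := by linarith
  have hpos : ∀ N : ℕ, 0 < w N ⌈y * N⌉₊ := fun N => by
    refine lt_of_lt_of_le ?_ (hlow N _)
    have : (0 : ℝ) < N.choose ⌈y * N⌉₊ := by exact_mod_cast Nat.choose_pos (hle N)
    positivity
  rw [tendsto_order]
  constructor
  · intro b hb
    filter_upwards [eventually_gt_atTop 0] with N hN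
    have hN' : (0 : ℝ) < N := by exact_mod_cast hN
    have h1 := Real.log_le_log (hpos N) (hup N ⌈y * N⌉₊)
    rw [one_mul, Real.log_mul (by positivity) (by positivity), Real.log_pow, Real.log_pow] at h1
    have h2 : (⌈y * N⌉₊ : ℝ) * Real.log (tilt q y) ≤ y * N * Real.log (tilt q y) :=
      mul_le_mul_of_nonpos_right (Nat.le_ceil _) (Real.log_nonpos hθ0.le hθ.2.le)
    have h3 := log_tilt_eq hq hqy hy
    have h4 : Real.log (w N ⌈y * N⌉₊) ≤ -binomialRate q y * N := by
      rw [← h3]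
      linarith
    rw [← mul_neg, one_div, lt_inv_mul_iff₀ hN']
    nlinarith
  · intro b hb
    obtain ⟨r, hr1, hr2⟩ := exists_between hb
    filter_upwards [eventually_exp_le_choose hq' hr1 (Eventually.of_forall hle)
      (tendsto_ceil_mul_div y hy0.le), eventually_gt_atTop 0] with N h1 hN
    have hN' : (0 : ℝ) < N := by exact_mod_cast hN
    have h2 := (Real.le_log_iff_exp_le (hpos N)).2 (h1.trans (hlow N _))
    rw [← mul_neg, one_div, inv_mul_lt_iff₀ hN']
    nlinarith

end Binomial

/-! ### Positivity of the binomial rate function. -/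

section Rates

/-- Gibbs' inequality: the rate is the relative entropy of the two Bernoulli laws. -/
theorem binomialRate_pos {q y : ℝ} (hq : q ∈ Set.Ioo (0 : ℝ) 1) (hy : y ∈ Set.Ioo (0 : ℝ) 1)
    (h : q ≠ y) : 0 < binomialRate q y := by
  have hq0 := hq.1
  have hq1 : 0 < 1 - q := by linarith [hq.2]
  have hy0 := hy.1
  have hy1 : 0 < 1 - y := by linarith [hy.2]
  have h1 : Real.log (q / y) < q / y - 1 :=
    Real.log_lt_sub_one_of_pos (by positivity) (by rw [Ne, div_eq_one_iff_eq hy0.ne']; exact h)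
  have h2 : Real.log ((1 - q) / (1 - y)) ≤ (1 - q) / (1 - y) - 1 :=
    Real.log_le_sub_one_of_pos (by positivity)
  have h3 := mul_lt_mul_of_pos_left h1 hy0
  have h4 := mul_le_mul_of_nonneg_left h2 hy1.le
  rw [Real.log_div hq0.ne' hy0.ne'] at h3
  rw [Real.log_div hq1.ne' hy1.ne'] at h4
  have e1 : y * (q / y - 1) = q - y := by field_simp
  have e2 : (1 - y) * ((1 - q) / (1 - y) - 1) = y - q := by field_simp; ring
  unfold binomialRate
  linarith

theorem binomialRate_self (q : ℝ) : binomialRate q q = 0 := by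
  unfold binomialRate
  ring

theorem binomialRate_nonneg {q y : ℝ} (hq : q ∈ Set.Ioo (0 : ℝ) 1) (hy : y ∈ Set.Ioo (0 : ℝ) 1) :
    0 ≤ binomialRate q y := by
  rcases eq_or_ne q y with rfl | h
  · rw [binomialRate_self]
  · exact (binomialRate_pos hq hy h).le

end Rates

/-! ### Competition of gains and losses in the recursive inequality. -/

section SignPattern

variable {w : ℕ → ℕ → ℝ} {f : ℝ}

/-- Unrolling B steps gives a sum over backward lattice paths. Only the paths ending at (N, n+1) are
kept; those leaving through column n or ending further right contribute nonnegative terms, by `hnn`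
and monotonicity. -/
theorem choose_mul_le_of_nonneg (hf : f ∈ Set.Ioo (0 : ℝ) 1) (hmono : ∀ N, Monotone (w N))
    (hlow : ∀ N n, f * w N n + (1 - f) * w N (n + 1) ≤ w (N + 1) (n + 1)) {N n : ℕ} (B j : ℕ)
    (hnn : ∀ m, N ≤ m → m ≤ N + B → 0 ≤ w m n) :
    (B.choose j : ℝ) * f ^ j * (1 - f) ^ (B - j) * w N (n + 1) ≤ w (N + B) (n + 1 + j) := by
  have hf0 := hf.1
  have hf1 : 0 < 1 - f := by linarith [hf.2]
  have hnn' : ∀ m, N ≤ m → m ≤ N + B → ∀ i, 0 ≤ w m (n + i) := fun m h1 h2 i =>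
    (hnn m h1 h2).trans (hmono m (by omega))
  induction B generalizing j with
  | zero =>
    cases j with
    | zero => simp
    | succ j => simpa [add_assoc] using hnn' N le_rfl (by omega) (1 + (j + 1))
  | succ B ih =>
    have ih' := fun j => ih j (fun m h1 h2 => hnn m h1 (by omega))
      (fun m h1 h2 => hnn' m h1 (by omega))
    have hs := hlow (N + B)
    cases j with
    | zero =>
      refine le_trans ?_ (hs n)
      have h1 := mul_le_mul_of_nonneg_left (ih' 0) hf1.le
      have h2 := mul_nonneg hf0.le (hnn (N + B) (by omega) (by omega))
      simp only [Nat.choose_zero_right, Nat.cast_one, pow_zero, one_mul, Nat.sub_zero,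
        add_zero] at h1 ⊢
      rw [pow_succ]
      linarith
    | succ j =>
      refine le_trans ?_ (hs (n + 1 + j))
      have h1 := mul_le_mul_of_nonneg_left (ih' j) hf0.le
      have h2 := mul_le_mul_of_nonneg_left (ih' (j + 1)) hf1.le
      refine le_trans (le_of_eq ?_) (add_le_add h1 h2)
      rw [Nat.choose_succ_succ]
      push_cast
      rcases Nat.lt_or_ge j B with h | h
      · have e : B - j = (B - (j + 1)) + 1 := by omega
        rw [e, pow_succ, pow_succ]
        ring
      · rw [Nat.choose_eq_zero_of_lt (by omega : B < j + 1)]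
        have e : B - j = 0 := by omega
        rw [e]
        simp
        ring

/-- Following the path that stays in column n+1, each step loses at most f E to column n, and the
geometric sum of the discounted losses is at most E. -/
theorem pow_mul_sub_le (hf : f ∈ Set.Ioo (0 : ℝ) 1)
    (hlow : ∀ N n, f * w N n + (1 - f) * w N (n + 1) ≤ w (N + 1) (n + 1)) {N n : ℕ} (K : ℕ)
    {E : ℝ} (hE : 0 ≤ E) (hloss : ∀ m, N ≤ m → m < N + K → -E ≤ w m n) :
    (1 - f) ^ K * w N (n + 1) - E ≤ w (N + K) (n + 1) := by
  have hf0 := hf.1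
  have hf1 : 0 < 1 - f := by linarith [hf.2]
  induction K with
  | zero => simpa using hE
  | succ K ih =>
    have h1 := mul_le_mul_of_nonneg_left (ih fun m h1 h2 => hloss m h1 (by omega)) hf1.le
    have h2 := mul_le_mul_of_nonneg_left (hloss (N + K) (by omega) (by omega)) hf0.le
    have h3 := hlow (N + K) n
    rw [pow_succ]
    rw [← add_assoc]
    linarith

/-- If `w` is positive above the slope `lam`, then above any larger slope it decays at most with
the rate of the binomial distribution. -/
theorem exp_rate_le_of_pos (hf : f ∈ Set.Ioo (0 : ℝ) 1) (hmono : ∀ N, Monotone (w N))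
    (hlow : ∀ N n, f * w N n + (1 - f) * w N (n + 1) ≤ w (N + 1) (n + 1))
    {lam lam' r : ℝ} (h0 : 0 ≤ lam) (hlt : lam < lam') (h1 : lam' < 1)
    (hr : binomialRate f lam' < r) {m₀ : ℕ}
    (hpos : ∀ N, m₀ ≤ N → ∀ n : ℕ, lam * N ≤ n → 0 < w N n) :
    ∃ c > 0, ∃ N₀ : ℕ, ∀ N, N₀ ≤ N → ∀ n : ℕ, lam' * N ≤ n → c * Real.exp (-r * N) ≤ w N n := by
  have h0' : 0 < lam' := by linarith
  have hf0 := hf.1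
  have hf1 : 0 < 1 - f := by linarith [hf.2]
  -- A fixed block of B rounds and ⌊lam' B⌋ columns costs a factor of at least exp(-rB); iterating
  -- blocks along the slope lam' yields the rate r for all N.
  obtain ⟨B, hB, hB0⟩ := ((eventually_exp_le_choose (j := fun N => ⌊lam' * N⌋₊) hf hr
    (Eventually.of_forall fun N => Nat.floor_le_of_le (by
      nlinarith [(Nat.cast_nonneg N : (0 : ℝ) ≤ N)]))
    ((tendsto_nat_floor_mul_div_atTop h0'.le).comp tendsto_natCast_atTop_atTop)).and
    (eventually_gt_atTop 0)).exists
  set j := ⌊lam' * B⌋₊ with hj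
  have hjB : (j : ℝ) ≤ lam' * B := Nat.floor_le (by positivity)
  -- From m₁ on, the column to the left of the starting column stays above slope lam during a whole
  -- block, and lam' m₁ ≥ 1 leaves room for that column.
  obtain ⟨m₁, hm₁⟩ := exists_nat_ge (max (m₀ : ℝ) (max ((1 + lam * B) / (lam' - lam)) (1 / lam')))
  have hm0 : (m₀ : ℝ) ≤ m₁ := (le_max_left _ _).trans hm₁
  have hm0' : m₀ ≤ m₁ := by exact_mod_cast hm0
  have hm2 : (1 + lam * B) / (lam' - lam) ≤ m₁ :=
    (le_max_left _ _).trans ((le_max_right _ _).trans hm₁)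
  have hm3 : 1 / lam' ≤ m₁ := (le_max_right _ _).trans ((le_max_right _ _).trans hm₁)
  rw [div_le_iff₀ (by linarith)] at hm2
  rw [div_le_iff₀ h0'] at hm3
  -- The constant c is the least rescaled value within the first block, the base of the strong
  -- induction with step B.
  obtain ⟨N₁, hN₁, hmin⟩ := (Finset.Ico m₁ (m₁ + B)).exists_min_image
    (fun N : ℕ => w N ⌈lam' * N⌉₊ * Real.exp (r * N)) ⟨m₁, by simp; omega⟩
  rw [Finset.mem_Ico] at hN₁
  have hslope : ∀ N n : ℕ, lam' * N ≤ n → lam * N ≤ n := fun N n h => by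
    nlinarith [(Nat.cast_nonneg N : (0 : ℝ) ≤ N)]
  have hc : 0 < w N₁ ⌈lam' * N₁⌉₊ * Real.exp (r * N₁) :=
    mul_pos (hpos _ (by omega) _ (hslope _ _ (Nat.le_ceil _))) (Real.exp_pos _)
  refine ⟨_, hc, m₁, ?_⟩
  generalize w N₁ ⌈lam' * N₁⌉₊ * Real.exp (r * N₁) = c at hc hmin
  intro N
  induction N using Nat.strong_induction_on with
  | _ N ih =>
    intro hN n hn
    rcases Nat.lt_or_ge N (m₁ + B) with hlt' | hge
    · have h2 := hmin N (by simp; omega)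
      have h3 : w N ⌈lam' * N⌉₊ ≤ w N n := hmono N (Nat.ceil_le.2 hn)
      have h4 := mul_le_mul_of_nonneg_right h2 (Real.exp_pos (-r * N)).le
      rw [mul_assoc, ← Real.exp_add] at h4
      have e : r * (N : ℝ) + -r * N = 0 := by ring
      rw [e, Real.exp_zero, mul_one] at h4
      exact h4.trans h3
    · obtain ⟨N', rfl⟩ : ∃ N', N = N' + B := ⟨N - B, by omega⟩
      push_cast at hn
      have hN' : (m₁ : ℝ) ≤ N' := by exact_mod_cast (by omega : m₁ ≤ N')
      have h2 : lam' * N' + j ≤ n := by linarith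
      have h3 : 1 + (j : ℝ) ≤ n := by nlinarith
      have h3' : 1 + j ≤ n := by exact_mod_cast h3
      obtain ⟨n', rfl⟩ : ∃ n', n = n' + 1 + j := ⟨n - j - 1, by omega⟩
      push_cast at h2
      have h4 := ih N' (by omega) (by omega) (n' + 1) (by push_cast; linarith)
      have h5 : ∀ m, N' ≤ m → m ≤ N' + B → 0 ≤ w m n' := fun m h6 h7 => by
        refine (hpos m (by omega) n' ?_).le
        have h8 : (m : ℝ) ≤ N' + B := by exact_mod_cast h7
        nlinarith
      have h6 := choose_mul_le_of_nonneg hf hmono hlow B j h5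
      refine le_trans ?_ h6
      have h7 := mul_le_mul hB h4 (by positivity) (by positivity)
      refine le_trans (le_of_eq ?_) h7
      push_cast
      rw [mul_left_comm, ← Real.exp_add]
      congr 2
      ring

set_option maxHeartbeats 400000 in
/-- A lower bound above a slope that decays slower than the possible losses extends the
positivity of `w` to a smaller slope. -/
theorem pos_of_exp_rate_le (hf : f ∈ Set.Ioo (0 : ℝ) 1)
    (hlow : ∀ N n, f * w N n + (1 - f) * w N (n + 1) ≤ w (N + 1) (n + 1))
    {C ρ θ l r : ℝ} (hC : 0 ≤ C) (hρ : 1 ≤ ρ) (hθ : θ ∈ Set.Ioo (0 : ℝ) 1)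
    (hloss : ∀ N n, -w N n ≤ C * ρ ^ N * θ ^ n) (hl : 0 < l) (hr0 : 0 ≤ r)
    (hr : Real.log ρ + l * Real.log θ < -r) :
    ∃ ε₀ > 0, ∀ ε > 0, ε ≤ ε₀ →
      (∃ c > 0, ∃ N₀ : ℕ, ∀ N, N₀ ≤ N → ∀ n : ℕ, (l + ε) * N ≤ n →
        c * Real.exp (-r * N) ≤ w N n) →
      ∃ N₀ : ℕ, ∀ N, N₀ ≤ N → ∀ n : ℕ, (l - ε) * N ≤ n → 0 < w N n := by
  have hf0 := hf.1
  have hf1 : 0 < 1 - f := by linarith [hf.2]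
  have hθ0 := hθ.1
  have hρ0 : 0 < ρ := by linarith
  have hT : Real.log θ < 0 := Real.log_neg hθ.1 hθ.2
  have hF : Real.log (1 - f) < 0 := Real.log_neg hf1 (by linarith)
  set T := Real.log θ with hTdef
  set F := Real.log (1 - f) with hFdef
  set R := Real.log ρ with hRdef
  have hFl : F / l < 0 := div_neg_of_neg_of_pos hF hl
  have hs : 0 < -T - 2 * (F / l) := by linarith
  have hgap : 0 < -(R + l * T + r) := by linarith
  -- The first bound keeps at least half of the gap between the two rates after moving to slope l -
  -- ε and paying for the waiting rounds below; the second gives κ ≤ 1/2 and l - ε > 0.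
  refine ⟨min (-(R + l * T + r) / 2 / (-T - 2 * (F / l))) (l / 4), by positivity, ?_⟩
  rintro ε hε hε₀ ⟨c, hc, N₀, hN₀⟩
  have h1 : ε ≤ -(R + l * T + r) / 2 / (-T - 2 * (F / l)) := hε₀.trans (min_le_left _ _)
  have h2 : ε ≤ l / 4 := hε₀.trans (min_le_right _ _)
  rw [le_div_iff₀ hs] at h1
  -- Going back a fraction κ of the rounds in the same column raises the slope from l - ε to at
  -- least l + ε, because (l + ε)(1 - κ) ≤ l - ε. The price is the factor (1 - f)^(κN), up to
  -- rounding.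
  set κ := 2 * ε / l with hκ
  have hκl : κ * l = 2 * ε := by rw [hκ]; field_simp
  have hκ0 : 0 < κ := by positivity
  have hκ1 : κ ≤ 1 / 2 := by
    rw [hκ, div_le_iff₀ hl]
    linarith
  set δ := -(R + (l - ε) * T + r - κ * F) with hδdef
  have hδ : 0 < δ := by
    have : κ * F = 2 * ε * (F / l) := by rw [hκ]; ring
    rw [hδdef, this]
    nlinarith
  -- The factor exp(-T) pays for measuring the losses one column to the left, exp F for rounding the
  -- number of waiting rounds up.
  have hev : ∀ᶠ N : ℕ in atTop, C * Real.exp (-T) / (c * Real.exp F) < Real.exp (δ * N) :=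
    (Real.tendsto_exp_atTop.comp
      ((tendsto_natCast_atTop_atTop (R := ℝ)).const_mul_atTop hδ)).eventually_gt_atTop _
  obtain ⟨N₁, hN₁⟩ := eventually_atTop.1 hev
  obtain ⟨N₂, hN₂⟩ := exists_nat_ge (1 / (l - ε))
  refine ⟨max N₁ (max (2 * N₀ + 2) N₂), fun N hN n hn => ?_⟩
  have hNN₁ : N₁ ≤ N := (le_max_left _ _).trans hN
  have hNN₀ : 2 * N₀ + 2 ≤ N := (le_max_left _ _).trans ((le_max_right _ _).trans hN)
  have hNN₂ : N₂ ≤ N := (le_max_right _ _).trans ((le_max_right _ _).trans hN)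
  have hlε : 0 < l - ε := by linarith
  have hn1 : (1 : ℝ) ≤ n := by
    have h3 : (N₂ : ℝ) ≤ N := by exact_mod_cast hNN₂
    have h4 := hN₂.trans h3
    rw [div_le_iff₀ hlε] at h4
    linarith
  have hn1' : 1 ≤ n := by exact_mod_cast hn1
  obtain ⟨n, rfl⟩ : ∃ n', n = n' + 1 := ⟨n - 1, by omega⟩
  push_cast at hn
  have hNr : (2 : ℝ) * N₀ + 2 ≤ N := by exact_mod_cast hNN₀
  have hN0 : (0 : ℝ) ≤ N := Nat.cast_nonneg N
  obtain ⟨K, hK1, hK2⟩ : ∃ K : ℕ, κ * N ≤ K ∧ (K : ℝ) < κ * N + 1 :=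
    ⟨_, Nat.le_ceil _, Nat.ceil_lt_add_one (by positivity)⟩
  have hK3 : (K : ℝ) + N₀ ≤ N := by
    have := mul_le_mul_of_nonneg_right hκ1 hN0
    linarith
  have hK3' : K + N₀ ≤ N := by exact_mod_cast hK3
  obtain ⟨m, rfl⟩ : ∃ m, N = m + K := ⟨N - K, by omega⟩
  have hmlow : c * Real.exp (-r * m) ≤ w m (n + 1) := by
    refine hN₀ m (by omega) (n + 1) ?_
    have h3 : (m : ℝ) ≤ (1 - κ) * (m + K : ℕ) := by
      push_cast at hK1 ⊢
      linarith
    have h4 : (l + ε) * (1 - κ) ≤ l - ε := by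
      have := mul_pos hε hκ0
      linarith
    have h5 := mul_le_mul_of_nonneg_left h3 (by linarith : 0 ≤ l + ε)
    have h6 := mul_le_mul_of_nonneg_right h4 hN0
    push_cast at *
    linarith
  set E := C * ρ ^ (m + K) * θ ^ n with hE
  have hE0 : 0 ≤ E := by positivity
  have hmain := pow_mul_sub_le hf hlow (N := m) (n := n) K hE0 (fun i h3 h4 => by
    have h5 : C * ρ ^ i * θ ^ n ≤ E := by
      rw [hE]
      gcongr
    linarith [hloss i n])
  refine lt_of_lt_of_le ?_ hmain
  rw [sub_pos]
  have hg : c * Real.exp F * Real.exp (-r * (m + K : ℕ) + κ * (m + K : ℕ) * F) ≤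
      (1 - f) ^ K * w m (n + 1) := by
    have h5 : Real.exp (F + κ * (m + K : ℕ) * F) ≤ (1 - f) ^ K := by
      rw [← Real.exp_log hf1, ← Real.exp_nat_mul, ← hFdef]
      apply Real.exp_le_exp.2
      have := mul_le_mul_of_nonpos_right hK2.le hF.le
      linarith
    have h6 : c * Real.exp (-r * (m + K : ℕ)) ≤ w m (n + 1) := by
      refine le_trans ?_ hmlow
      gcongr c * Real.exp ?_
      push_cast
      have := mul_nonneg hr0 (Nat.cast_nonneg K)
      linarith
    refine le_trans (le_of_eq ?_) (mul_le_mul h5 h6 (by positivity) (by positivity))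
    rw [Real.exp_add, Real.exp_add]
    ring
  refine lt_of_lt_of_le ?_ hg
  have hEle : E ≤ C * Real.exp (-T) * Real.exp ((R + (l - ε) * T) * (m + K : ℕ)) := by
    have h5 : θ ^ n ≤ Real.exp (((l - ε) * (m + K : ℕ) - 1) * T) := by
      rw [← Real.exp_log hθ0, ← Real.exp_nat_mul, ← hTdef]
      apply Real.exp_le_exp.2
      exact mul_le_mul_of_nonpos_right (by linarith) hT.le
    have h6 : ρ ^ (m + K) = Real.exp ((m + K : ℕ) * R) := by
      rw [Real.exp_nat_mul, hRdef, Real.exp_log hρ0]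
    rw [hE, h6]
    refine (mul_le_mul_of_nonneg_left h5 (by positivity)).trans (le_of_eq ?_)
    rw [mul_assoc, ← Real.exp_add, mul_assoc C, ← Real.exp_add]
    congr 2
    ring
  refine lt_of_le_of_lt hEle ?_
  have h7 := hN₁ (m + K) hNN₁
  rw [div_lt_iff₀ (by positivity)] at h7
  have h8 := mul_lt_mul_of_pos_right h7 (Real.exp_pos ((R + (l - ε) * T) * (m + K : ℕ)))
  refine lt_of_lt_of_eq h8 ?_
  rw [mul_comm (Real.exp (δ * _)), mul_assoc, ← Real.exp_add]
  congr 2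
  rw [hδdef]
  ring

/-- The exponential rate of losses minus that of gains. -/
noncomputable def rateGap (a f y : ℝ) : ℝ :=
  y * Real.log (f / a) + (1 - y) * Real.log ((1 - f) / (1 - a))

theorem rateGap_eq {a f : ℝ} (ha : 0 < a) (haf : a < f) (hf : f < 1) (y : ℝ) :
    rateGap a f y = binomialRate a y - binomialRate f y := by
  unfold rateGap binomialRate
  rw [Real.log_div (by linarith) (by linarith), Real.log_div (by linarith) (by linarith)]
  ring

/-- The entropy terms cancel in the difference of the rates, which leaves an affine function of y
with positive slope. -/
theorem rateGap_strictMono {a f : ℝ} (ha : 0 < a) (haf : a < f) (hf : f < 1) :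
    StrictMono (rateGap a f) := by
  intro y z hyz
  have h1 : 0 < Real.log (f / a) := Real.log_pos (by rwa [one_lt_div ha])
  have h2 : Real.log ((1 - f) / (1 - a)) < 0 :=
    Real.log_neg (div_pos (by linarith) (by linarith))
      (by rw [div_lt_one (by linarith)]; linarith)
  unfold rateGap
  nlinarith

theorem rateGap_left_neg {a f : ℝ} (ha : 0 < a) (haf : a < f) (hf : f < 1) :
    rateGap a f a < 0 := by
  rw [rateGap_eq ha haf hf, binomialRate_self]
  have := binomialRate_pos (q := f) (y := a) ⟨by linarith, hf⟩ ⟨ha, by linarith⟩ haf.ne'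
  linarith

theorem rateGap_right_pos {a f : ℝ} (ha : 0 < a) (haf : a < f) (hf : f < 1) :
    0 < rateGap a f f := by
  rw [rateGap_eq ha haf hf, binomialRate_self]
  have := binomialRate_pos (q := a) (y := f) ⟨ha, by linarith⟩ ⟨by linarith, hf⟩ haf.ne
  linarith

/-- Above every slope at which gains prevail over losses, `w` is eventually positive. -/
theorem eventually_pos_of_rateGap_pos {a g C : ℝ} (ha : 0 < a) (haf : a < f) (hf1 : f < 1)
    (hmono : ∀ N, Monotone (w N))
    (hlow : ∀ N n, f * w N n + (1 - f) * w N (n + 1) ≤ w (N + 1) (n + 1))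
    (hg : 0 < g) (htop : ∀ N n, N < n → g ≤ w N n) (hC : 0 ≤ C)
    (hloss : ∀ θ ∈ Set.Ioo (0 : ℝ) 1, ∀ N n, -w N n ≤ C * (a / θ + (1 - a)) ^ N * θ ^ n)
    {lam : ℝ} (hlam : 0 < rateGap a f lam) :
    ∃ N₀ : ℕ, ∀ N, N₀ ≤ N → ∀ n : ℕ, lam * N ≤ n → 0 < w N n := by
  have hf : f ∈ Set.Ioo (0 : ℝ) 1 := ⟨by linarith, hf1⟩
  have hρ : ∀ θ ∈ Set.Ioo (0 : ℝ) 1, 1 ≤ a / θ + (1 - a) := fun θ hθ => by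
    have : a ≤ a / θ := by
      rw [le_div_iff₀ hθ.1]
      nlinarith [hθ.2]
    linarith
  by_contra hcon
  -- The set of good slopes is an up-set containing everything above 1. If lam were not in it, its
  -- infimum l would have positive rate gap, and pushing positivity to l - ε would contradict
  -- minimality.
  set S : Set ℝ := {s | ∃ N₀ : ℕ, ∀ N, N₀ ≤ N → ∀ n : ℕ, s * N ≤ n → 0 < w N n} with hS
  have hup : ∀ s ∈ S, ∀ t, s ≤ t → t ∈ S := by
    rintro s ⟨N₀, hN₀⟩ t hst
    refine ⟨N₀, fun N hN n hn => hN₀ N hN n (le_trans ?_ hn)⟩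
    gcongr
  have hbdd : ∀ s ∈ S, lam ≤ s := fun s hs => by
    by_contra hlt
    exact hcon (hup s hs lam (not_le.1 hlt).le)
  have hge1 : ∀ s : ℝ, 1 < s → ∀ N n : ℕ, 1 ≤ N → s * N ≤ n → g ≤ w N n := by
    intro s hs N n hN hn
    apply htop
    have : (1 : ℝ) ≤ N := by exact_mod_cast hN
    have : (N : ℝ) < n := by nlinarith
    exact_mod_cast this
  have hone : ∀ s : ℝ, 1 < s → s ∈ S := fun s hs =>
    ⟨1, fun N hN n hn => hg.trans_le (hge1 s hs N n hN hn)⟩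
  have hBB : BddBelow S := ⟨lam, hbdd⟩
  have hne : S.Nonempty := ⟨2, hone 2 (by norm_num)⟩
  set l := sInf S with hl
  have hlaml : lam ≤ l := le_csInf hne hbdd
  have hl1 : l ≤ 1 := le_of_forall_gt_imp_ge_of_dense fun s hs => csInf_le hBB (hone s hs)
  have hlS : ∀ s, l < s → s ∈ S := fun s hs => by
    obtain ⟨t, ht, hts⟩ := exists_lt_of_csInf_lt hne hs
    exact hup t ht s hts.le
  have hgapl : 0 < rateGap a f l :=
    hlam.trans_le ((rateGap_strictMono ha haf hf1).monotone hlaml)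
  have hal : a < l := by
    by_contra h
    have := (rateGap_strictMono ha haf hf1).monotone (not_lt.1 h)
    linarith [rateGap_left_neg ha haf hf1]
  have hl0 : 0 < l := by linarith
  have hcontra : ∀ ε > 0, l - ε ∉ S := fun ε hε h => by
    have := csInf_le hBB h
    linarith
  rcases hl1.lt_or_eq with hl1 | hl1
  · rw [rateGap_eq ha haf hf1, sub_pos] at hgapl
    obtain ⟨r, hr1, hr2⟩ := exists_between hgapl
    have hr0 : 0 ≤ r := (binomialRate_nonneg hf ⟨hl0, hl1⟩).trans hr1.le
    have hθ := tilt_mem ha hal hl1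
    obtain ⟨ε₀, hε₀, hstep⟩ := pos_of_exp_rate_le hf hlow hC (hρ _ hθ) hθ (hloss _ hθ) hl0 hr0
      (by rw [log_tilt_eq ha hal hl1]; linarith)
    have hcont : ∀ᶠ ε : ℝ in 𝓝[>] 0, binomialRate f (l + ε) < r ∧ l + ε < 1 ∧ ε ≤ ε₀ := by
      apply nhdsWithin_le_nhds
      have hc1 : Tendsto (fun ε : ℝ => l + ε) (𝓝 0) (𝓝 l) := by
        have : Continuous fun ε : ℝ => l + ε := by fun_prop
        simpa using this.tendsto 0
      have hc2 := ((continuous_binomialRate f).tendsto l).comp hc1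
      filter_upwards [hc2.eventually (gt_mem_nhds hr1), hc1.eventually (gt_mem_nhds hl1),
        ge_mem_nhds hε₀] with ε h1 h2 h3 using ⟨h1, h2, h3⟩
    obtain ⟨ε, ⟨h1, h2, h3⟩, hε⟩ := (hcont.and self_mem_nhdsWithin).exists
    have hε : 0 < ε := hε
    -- Positivity from l + ε/2 on gives the gain rate r above l + ε, which in turn reaches l - ε.
    obtain ⟨m₀, hm₀⟩ := hlS (l + ε / 2) (by linarith)
    exact hcontra ε hε (hstep ε hε h3
      (exp_rate_le_of_pos hf hmono hlow (by linarith) (by linarith) h2 h1 hm₀))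
  -- At l = 1 the optimal tilt degenerates to 0. Any small θ makes the losses decay exponentially at
  -- slope 1, while the values above slope 1 stay at least g, that is, gain rate 0.
  · have hlim : Tendsto (fun θ : ℝ => a + (1 - a) * θ) (𝓝[>] 0) (𝓝 a) := by
      have : Continuous fun θ : ℝ => a + (1 - a) * θ := by fun_prop
      have h := this.tendsto 0
      simp only [mul_zero, add_zero] at h
      exact h.mono_left nhdsWithin_le_nhds
    have hev : ∀ᶠ θ : ℝ in 𝓝[>] 0, θ ∈ Set.Ioo (0 : ℝ) 1 :=
      Ioo_mem_nhdsGT one_pos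
    obtain ⟨θ, hθ, hθa⟩ := (hev.and (hlim.eventually (gt_mem_nhds (haf.trans hf1)))).exists
    have hθ0 := hθ.1
    obtain ⟨ε₀, hε₀, hstep⟩ := pos_of_exp_rate_le hf hlow hC (hρ _ hθ) hθ (hloss _ hθ) hl0 le_rfl
      (by
        rw [hl1, one_mul, neg_zero, ← Real.log_mul (by linarith [hρ _ hθ]) hθ0.ne']
        apply Real.log_neg (mul_pos (by linarith [hρ _ hθ]) hθ0)
        calc (a / θ + (1 - a)) * θ = a + (1 - a) * θ := by field_simp
          _ < 1 := hθa)
    refine hcontra ε₀ hε₀ (hstep ε₀ hε₀ le_rfl ⟨g, hg, 1, fun N hN n hn => ?_⟩)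
    simp only [neg_zero, zero_mul, Real.exp_zero, mul_one]
    exact hge1 (l + ε₀) (by linarith) N n hN hn

end SignPattern

/-! ### Slot values and the slope at which they cross x_i. -/

section SlotValue

/-- The point of `[a, b]` nearest to `z`. -/
noncomputable def clamp (z a b : ℝ) : ℝ := max a (min b z)

theorem le_clamp (z a b : ℝ) : a ≤ clamp z a b := le_max_left _ _

theorem clamp_le {a b : ℝ} (h : a ≤ b) (z : ℝ) : clamp z a b ≤ b :=
  max_le h (min_le_left _ _)

theorem min_le_clamp (z a b : ℝ) : min b z ≤ clamp z a b := le_max_right _ _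

theorem clamp_neg {a b : ℝ} (h : a ≤ b) (z : ℝ) : clamp (-z) (-b) (-a) = -clamp z a b := by
  unfold clamp
  rw [min_neg_neg, max_neg_neg, neg_inj]
  rcases le_total b z with h1 | h1
  · simp [h1, h.trans h1, h]
  · rcases le_total a z with h2 | h2 <;> simp [h1, h2, h]

/-- Of two adjacent intervals at most one has z in its interior; the other contributes an endpoint.
This makes sums of clamps telescope. -/
theorem clamp_add_clamp {a b c z : ℝ} (hab : a ≤ b) (hbc : b ≤ c) :
    clamp z a b + clamp z b c = clamp z a c + b := by
  unfold clamp
  rcases le_total b z with h1 | h1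
  · have h2 : b ≤ min c z := le_min hbc h1
    rw [min_eq_left h1, max_eq_right hab, max_eq_right h2, max_eq_right (hab.trans h2)]
    ring
  · rw [min_eq_right h1, min_eq_right (h1.trans hbc), max_eq_left h1]

theorem clamp_eq_self_iff {a b z : ℝ} (hab : a ≤ b) : clamp z a b = z ↔ a ≤ z ∧ z ≤ b := by
  constructor
  · intro h
    rw [← h]
    exact ⟨le_clamp _ _ _, clamp_le hab _⟩
  · rintro ⟨h1, h2⟩
    rw [clamp, min_eq_right h2, max_eq_right h1]

variable {k : ℕ} {p x : Fin k → ℝ} {lo hi : ℝ}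

/-- The expected value placed by a threshold policy at the `n`-th of `N` empty locations, with
the conventions `lo` for `n = 0` and `hi` for `n > N`. -/
noncomputable def slotValue (p x : Fin k → ℝ) (lo hi : ℝ) : ℕ → ℕ → ℝ
  | 0, 0 => lo
  | 0, _ + 1 => hi
  | _ + 1, 0 => lo
  | N + 1, n + 1 => ∑ j, p j * clamp (x j) (slotValue p x lo hi N n) (slotValue p x lo hi N (n + 1))

theorem slotValue_zero (N : ℕ) : slotValue p x lo hi N 0 = lo := by
  cases N <;> rw [slotValue]

theorem slotValue_succ (N n : ℕ) : slotValue p x lo hi (N + 1) (n + 1) =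
    ∑ j, p j * clamp (x j) (slotValue p x lo hi N n) (slotValue p x lo hi N (n + 1)) := by
  rw [slotValue]

theorem slotValue_of_lt (hsum : ∑ i, p i = 1) {N n : ℕ} (h : N < n) :
    slotValue p x lo hi N n = hi := by
  induction N generalizing n with
  | zero =>
    obtain ⟨n, rfl⟩ : ∃ m, n = m + 1 := ⟨n - 1, by omega⟩
    rw [slotValue]
  | succ N ih =>
    obtain ⟨n, rfl⟩ : ∃ m, n = m + 1 := ⟨n - 1, by omega⟩
    rw [slotValue_succ, ih (by omega), ih (by omega)]
    simp [clamp, ← Finset.sum_mul, hsum]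

/-- Consecutive rows interlace: V(N,n) ≤ V(N+1,n+1) ≤ V(N,n+1), as an average of clamps stays in the
interval. -/
theorem slotValue_monotone (hp : ∀ i, 0 < p i) (hsum : ∑ i, p i = 1) (hlh : lo ≤ hi) (N : ℕ) :
    Monotone (slotValue p x lo hi N) := by
  induction N with
  | zero =>
    refine monotone_nat_of_le_succ fun n => ?_
    cases n <;> simp [slotValue, hlh]
  | succ N ih =>
    have h1 : ∀ n, slotValue p x lo hi N n ≤ slotValue p x lo hi (N + 1) (n + 1) := fun n => by
      rw [slotValue_succ]
      calc slotValue p x lo hi N n = ∑ j, p j * slotValue p x lo hi N n := by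
            rw [← Finset.sum_mul, hsum, one_mul]
        _ ≤ _ := Finset.sum_le_sum fun j _ => mul_le_mul_of_nonneg_left (le_clamp _ _ _) (hp j).le
    have h2 : ∀ n, slotValue p x lo hi (N + 1) (n + 1) ≤ slotValue p x lo hi N (n + 1) :=
      fun n => by
      rw [slotValue_succ]
      calc _ ≤ ∑ j, p j * slotValue p x lo hi N (n + 1) := Finset.sum_le_sum fun j _ =>
            mul_le_mul_of_nonneg_left (clamp_le (ih n.le_succ) _) (hp j).le
        _ = slotValue p x lo hi N (n + 1) := by rw [← Finset.sum_mul, hsum, one_mul]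
    refine monotone_nat_of_le_succ fun n => ?_
    cases n with
    | zero =>
      refine le_trans (le_of_eq ?_) (h1 0)
      rw [slotValue_zero, slotValue_zero]
    | succ n => exact (h2 n).trans (h1 (n + 1))

theorem lo_le_slotValue (hp : ∀ i, 0 < p i) (hsum : ∑ i, p i = 1) (hlh : lo ≤ hi) (N n : ℕ) :
    lo ≤ slotValue p x lo hi N n :=
  (slotValue_zero N).ge.trans (slotValue_monotone hp hsum hlh N n.zero_le)

/-- Reflection symmetry, exchanging the boundary columns 0 and N+1. It turns every lower bound on
slot values into an upper bound. -/
theorem slotValue_rev (hp : ∀ i, 0 < p i) (hsum : ∑ i, p i = 1) (hlh : lo ≤ hi) {N n : ℕ}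
    (h : n ≤ N + 1) :
    slotValue (fun j => p j.rev) (fun j => -x j.rev) (-hi) (-lo) N n =
      -slotValue p x lo hi N (N + 1 - n) := by
  have hsum' : ∑ j : Fin k, p j.rev = 1 := by
    rw [← hsum]
    exact Equiv.sum_comp Fin.revPerm p
  cases n with
  | zero => rw [slotValue_zero, slotValue_of_lt hsum (by omega)]
  | succ n =>
    induction N generalizing n with
    | zero =>
      obtain rfl : n = 0 := by omega
      simp [slotValue]
    | succ N ih =>
      rcases Nat.lt_or_ge n (N + 1) with hn | hn
      · have e : N + 1 + 1 - (n + 1) = (N - n) + 1 := by omega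
        have e1 : slotValue (fun j => p j.rev) (fun j => -x j.rev) (-hi) (-lo) N n =
            -slotValue p x lo hi N (N - n + 1) := by
          cases n with
          | zero => rw [slotValue_zero, slotValue_of_lt hsum (by omega)]
          | succ n =>
            rw [ih n (by omega)]
            congr 2
            omega
        have e2 : N + 1 - (n + 1) = N - n := by omega
        rw [e, slotValue_succ, slotValue_succ, ih n (by omega), e1, e2, ← Finset.sum_neg_distrib]
        rw [← Equiv.sum_comp Fin.revPerm (fun j => -(p j * _))]
        refine Finset.sum_congr rfl fun j _ => ?_
        rw [clamp_neg (slotValue_monotone hp hsum hlh N (Nat.le_succ _)), Fin.revPerm_apply]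
        ring
      · obtain rfl : n = N + 1 := by omega
        rw [slotValue_of_lt hsum' (by omega)]
        simp [slotValue_zero]

theorem cumLT_add (p : Fin k → ℝ) (i : Fin k) : cumLT p i + p i = cumLE p i := by
  unfold cumLT cumLE
  have : (Finset.univ.filter fun j => j ≤ i) = insert i (Finset.univ.filter fun j => j < i) := by
    ext j
    simp [le_iff_eq_or_lt]
  rw [this, Finset.sum_insert (by simp)]
  ring

theorem cumLE_compl (hsum : ∑ i, p i = 1) (i : Fin k) : ∑ j with i < j, p j = 1 - cumLE p i := by
  rw [← hsum, ← Finset.sum_filter_add_sum_filter_not Finset.univ (fun j => j ≤ i) p, cumLE]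
  simp

theorem cumLT_compl (hsum : ∑ i, p i = 1) (i : Fin k) : ∑ j with i ≤ j, p j = 1 - cumLT p i := by
  rw [← hsum, ← Finset.sum_filter_add_sum_filter_not Finset.univ (fun j => j < i) p, cumLT]
  simp

theorem cumLT_rev (hsum : ∑ i, p i = 1) (i : Fin k) :
    cumLT (fun j => p j.rev) i.rev = 1 - cumLE p i := by
  rw [← cumLE_compl hsum, cumLT, Finset.sum_filter, Finset.sum_filter,
    ← Equiv.sum_comp Fin.revPerm]
  simp [Fin.rev_lt_rev]

theorem cumLE_rev (hsum : ∑ i, p i = 1) (i : Fin k) :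
    cumLE (fun j => p j.rev) i.rev = 1 - cumLT p i := by
  rw [← cumLT_compl hsum, cumLE, Finset.sum_filter, Finset.sum_filter,
    ← Equiv.sum_comp Fin.revPerm]
  simp [Fin.rev_le_rev]

theorem cumLT_pos (hp : ∀ i, 0 < p i) {i : Fin k} (hi : 0 < (i : ℕ)) : 0 < cumLT p i := by
  unfold cumLT
  refine Finset.sum_pos (fun j _ => hp j) ⟨⟨0, by omega⟩, ?_⟩
  rw [Finset.mem_filter]
  exact ⟨Finset.mem_univ _, hi⟩

theorem cumLE_lt_one (hp : ∀ i, 0 < p i) (hsum : ∑ i, p i = 1) {i : Fin k}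
    (hi : (i : ℕ) + 1 < k) : cumLE p i < 1 := by
  have : 0 < ∑ j with i < j, p j := by
    refine Finset.sum_pos (fun j _ => hp j) ⟨⟨i + 1, hi⟩, ?_⟩
    rw [Finset.mem_filter]
    exact ⟨Finset.mem_univ _, Nat.lt_succ_self _⟩
  rw [cumLE_compl hsum] at this
  linarith

theorem cumLT_lt_cumLE (hp : ∀ i, 0 < p i) (i : Fin k) : cumLT p i < cumLE p i := by
  rw [← cumLT_add]
  linarith [hp i]

/-- A lower bound of an average by the averages of two parts. -/
theorem le_sum_of_split {s : Fin k → Prop} [DecidablePred s] (hp : ∀ i, 0 < p i)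
    {v : Fin k → ℝ} {A B : ℝ} (hA : ∀ j, s j → A ≤ v j) (hB : ∀ j, ¬s j → B ≤ v j) :
    (∑ j with s j, p j) * A + (∑ j with ¬s j, p j) * B ≤ ∑ j, p j * v j := by
  rw [← Finset.sum_filter_add_sum_filter_not Finset.univ s (fun j => p j * v j), Finset.sum_mul,
    Finset.sum_mul]
  refine add_le_add (Finset.sum_le_sum fun j hj => ?_) (Finset.sum_le_sum fun j hj => ?_)
  · exact mul_le_mul_of_nonneg_left (hA j (Finset.mem_filter.1 hj).2) (hp j).le
  · exact mul_le_mul_of_nonneg_left (hB j (Finset.mem_filter.1 hj).2) (hp j).le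

/-- Above the critical slope the slot values eventually exceed `x i`. -/
theorem eventually_lt_slotValue (hp : ∀ i, 0 < p i) (hsum : ∑ i, p i = 1) (hx : StrictMono x)
    (hlo : ∀ j, lo ≤ x j) (hhi : ∀ j, x j ≤ hi) {i : Fin k} (hi0 : 0 < (i : ℕ))
    (hik : (i : ℕ) + 1 < k) {lam : ℝ} (hlam : 0 < rateGap (cumLT p i) (cumLE p i) lam) :
    ∃ N₀ : ℕ, ∀ N, N₀ ≤ N → ∀ n : ℕ, lam * N ≤ n → x i < slotValue p x lo hi N n := by
  have hlh : lo ≤ hi := (hlo i).trans (hhi i)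
  set V := slotValue p x lo hi with hV
  set i' : Fin k := ⟨i + 1, hik⟩ with hi'
  have hii' : i < i' := by simp [hi', Fin.lt_def]
  set g := x i' - x i with hg
  have hg0 : 0 < g := sub_pos.2 (hx hii')
  -- An observation above x_i guarantees only min(V(N,n+1), x_{i+1}); truncating at g = x_{i+1} -
  -- x_i makes the linear recursion hold for either sign of w.
  set w : ℕ → ℕ → ℝ := fun N n => min (V N n - x i) g with hw
  have ha := cumLT_pos hp hi0
  have hf1 := cumLE_lt_one hp hsum hik
  have haf := cumLT_lt_cumLE hp i
  have hVm : ∀ N, Monotone (V N) := slotValue_monotone hp hsum hlh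
  have hlow : ∀ N n, cumLE p i * w N n + (1 - cumLE p i) * w N (n + 1) ≤ w (N + 1) (n + 1) := by
    intro N n
    have h := le_sum_of_split (s := fun j => j ≤ i) (A := w N n + x i) (B := w N (n + 1) + x i)
      (v := fun j => clamp (x j) (V N n) (V N (n + 1))) hp
      (fun j _ => le_trans (by linarith [min_le_left (V N n - x i) g]) (le_clamp _ _ _))
      (fun j hj => by
        refine le_trans ?_ (min_le_clamp _ _ _)
        have h1 : x i' ≤ x j := hx.monotone (by
          rw [not_le, Fin.lt_def] at hj
          rw [Fin.le_def]
          exact hj)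
        refine le_min (by linarith [min_le_left (V N (n + 1) - x i) g]) ?_
        linarith [min_le_right (V N (n + 1) - x i) g])
    simp only [not_le] at h
    rw [cumLE_compl hsum, ← slotValue_succ] at h
    refine le_min ?_ ?_
    · rw [cumLE] at h ⊢
      linarith
    · have h1 : w N n ≤ g := min_le_right _ _
      have h2 : w N (n + 1) ≤ g := min_le_right _ _
      nlinarith
  have hmono : ∀ N, Monotone (w N) := fun N m n hmn =>
    min_le_min_right _ (sub_le_sub_right (hVm N hmn) _)
  have htop : ∀ N n, N < n → g ≤ w N n := fun N n h => by
    refine le_min ?_ le_rfl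
    rw [hV, slotValue_of_lt hsum h]
    linarith [hhi i']
  have hC : 0 ≤ x i - lo := by linarith [hlo i]
  have hloss : ∀ θ ∈ Set.Ioo (0 : ℝ) 1, ∀ N n,
      -w N n ≤ (x i - lo) * (cumLT p i / θ + (1 - cumLT p i)) ^ N * θ ^ n := by
    intro θ hθ N n
    -- An observation at least x_i cannot make the deficit worse than in column n+1, so the deficit
    -- moves left only with probability `cumLT p i`.
    have h := binomialTail_le (w := fun N n => max (x i - V N n) 0) ⟨ha, by linarith⟩ hθ hC
      (fun N => by
        simp only [hV, slotValue_zero]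
        exact max_le le_rfl hC)
      (fun n => by
        simp only [hV, slotValue_of_lt hsum (Nat.succ_pos n)]
        exact max_le (by linarith [hhi i]) le_rfl)
      (fun N n => by
        have h := le_sum_of_split (s := fun j => j < i) (A := x i - max (x i - V N n) 0)
          (B := x i - max (x i - V N (n + 1)) 0)
          (v := fun j => clamp (x j) (V N n) (V N (n + 1))) hp
          (fun j _ => le_trans (by linarith [le_max_left (x i - V N n) 0]) (le_clamp _ _ _))
          (fun j hj => by
            refine le_trans ?_ (min_le_clamp _ _ _)
            have h1 : x i ≤ x j := hx.monotone (not_lt.1 hj)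
            refine le_min (by linarith [le_max_left (x i - V N (n + 1)) 0]) ?_
            linarith [le_max_right (x i - V N (n + 1)) 0])
        simp only [not_lt] at h
        rw [cumLT_compl hsum, ← slotValue_succ] at h
        refine max_le ?_ ?_
        · rw [cumLT] at h ⊢
          linarith
        · have h1 : 0 ≤ max (x i - V N n) 0 := le_max_right _ _
          have h2 : 0 ≤ max (x i - V N (n + 1)) 0 := le_max_right _ _
          have h3 : 0 ≤ 1 - cumLT p i := by linarith
          positivity) N n
    refine le_trans ?_ h
    rw [neg_le]
    refine le_min ?_ ?_
    · linarith [le_max_left (x i - V N n) 0]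
    · linarith [le_max_right (x i - V N n) 0]
  obtain ⟨N₀, hN₀⟩ := eventually_pos_of_rateGap_pos ha haf hf1 hmono hlow hg0 htop hC hloss hlam
  refine ⟨N₀, fun N hN n hn => ?_⟩
  have := (lt_min_iff.1 (hN₀ N hN n hn)).1
  linarith

theorem rateGap_compl (a f y : ℝ) : rateGap (1 - f) (1 - a) (1 - y) = -rateGap a f y := by
  unfold rateGap
  simp only [sub_sub_cancel]
  rw [← inv_div f a, ← inv_div (1 - f) (1 - a), Real.log_inv, Real.log_inv]
  ring

/-- Below the critical slope the slot values are eventually below `x i`. -/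
theorem eventually_slotValue_lt (hp : ∀ i, 0 < p i) (hsum : ∑ i, p i = 1) (hx : StrictMono x)
    (hlo : ∀ j, lo ≤ x j) (hhi : ∀ j, x j ≤ hi) {i : Fin k} (hi0 : 0 < (i : ℕ))
    (hik : (i : ℕ) + 1 < k) {lam : ℝ} (hlam : rateGap (cumLT p i) (cumLE p i) lam < 0) :
    ∃ N₀ : ℕ, ∀ N, N₀ ≤ N → ∀ n : ℕ, n ≤ N → n ≤ lam * N → slotValue p x lo hi N n < x i := by
  obtain ⟨N₀, hN₀⟩ := eventually_lt_slotValue (p := fun j => p j.rev) (x := fun j => -x j.rev)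
    (lo := -hi) (hi := -lo) (i := i.rev) (lam := 1 - lam) (fun j => hp _)
    (by rw [← hsum]; exact Equiv.sum_comp Fin.revPerm p)
    (fun j l hjl => neg_lt_neg (hx (Fin.rev_lt_rev.2 hjl))) (fun j => neg_le_neg (hhi _))
    (fun j => neg_le_neg (hlo _)) (by rw [Fin.val_rev]; omega) (by rw [Fin.val_rev]; omega)
    (by
      rw [cumLT_rev hsum, cumLE_rev hsum, rateGap_compl]
      linarith)
  refine ⟨N₀, fun N hN n hn hnl => ?_⟩
  have h := hN₀ N hN (N + 1 - n) (by
    push_cast [show n ≤ N + 1 by omega]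
    linarith)
  rw [slotValue_rev hp hsum ((hlo i).trans (hhi i)) (by omega), Fin.rev_rev,
    show N + 1 - (N + 1 - n) = n by omega] at h
  linarith

theorem limitLocation_eq {i : Fin k} (hi0 : 0 < (i : ℕ)) (hik : (i : ℕ) + 1 < k) :
    limitLocation p i = Real.log ((1 - cumLE p i) / (1 - cumLT p i)) /
      Real.log (cumLT p i * (1 - cumLE p i) / ((1 - cumLT p i) * cumLE p i)) := by
  rw [limitLocation, if_neg hi0.ne', if_neg hik.ne]

theorem rateGap_limitLocation (hp : ∀ i, 0 < p i) (hsum : ∑ i, p i = 1) {i : Fin k}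
    (hi0 : 0 < (i : ℕ)) (hik : (i : ℕ) + 1 < k) :
    rateGap (cumLT p i) (cumLE p i) (limitLocation p i) = 0 := by
  have ha := cumLT_pos hp hi0
  have hf1 := cumLE_lt_one hp hsum hik
  have haf := cumLT_lt_cumLE hp i
  rw [limitLocation_eq hi0 hik]
  generalize cumLT p i = a at *
  generalize cumLE p i = f at *
  have hf0 : 0 < f := by linarith
  have h1 : 0 < 1 - f := by linarith
  have h2 : 0 < 1 - a := by linarith
  have h3 : 0 < Real.log (f / a) := Real.log_pos (by rwa [one_lt_div ha])
  have h4 : Real.log ((1 - f) / (1 - a)) < 0 :=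
    Real.log_neg (by positivity) (by rw [div_lt_one h2]; linarith)
  have e : a * (1 - f) / ((1 - a) * f) = (1 - f) / (1 - a) / (f / a) := by field_simp
  rw [e, Real.log_div (x := (1 - f) / (1 - a)) (by positivity) (by positivity), rateGap]
  have h5 : Real.log ((1 - f) / (1 - a)) - Real.log (f / a) ≠ 0 := by linarith
  generalize Real.log ((1 - f) / (1 - a)) = u at *
  generalize Real.log (f / a) = v at *
  field_simp
  ring

theorem limitLocation_mem (hp : ∀ i, 0 < p i) (hsum : ∑ i, p i = 1) {i : Fin k}
    (hi0 : 0 < (i : ℕ)) (hik : (i : ℕ) + 1 < k) :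
    limitLocation p i ∈ Set.Ioo (cumLT p i) (cumLE p i) := by
  have ha := cumLT_pos hp hi0
  have hf1 := cumLE_lt_one hp hsum hik
  have haf := cumLT_lt_cumLE hp i
  have hd := rateGap_limitLocation hp hsum hi0 hik
  have hm := rateGap_strictMono ha haf hf1
  constructor
  · rw [← hm.lt_iff_lt, hd]
    exact rateGap_left_neg ha haf hf1
  · rw [← hm.lt_iff_lt, hd]
    exact rateGap_right_pos ha haf hf1

theorem binomialRate_eq_iff (hp : ∀ i, 0 < p i) (hsum : ∑ i, p i = 1) {i : Fin k}
    (hi0 : 0 < (i : ℕ)) (hik : (i : ℕ) + 1 < k) (y : ℝ) :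
    binomialRate (cumLT p i) y = binomialRate (cumLE p i) y ↔ y = limitLocation p i := by
  have ha := cumLT_pos hp hi0
  have hf1 := cumLE_lt_one hp hsum hik
  have haf := cumLT_lt_cumLE hp i
  rw [← (rateGap_strictMono ha haf hf1).injective.eq_iff (a := y),
    rateGap_limitLocation hp hsum hi0 hik, rateGap_eq ha haf hf1, sub_eq_zero]

/-- For the smallest value there are no losses: V ≥ lo = x_i always, and the larger value x_j, of
positive probability, makes the average strictly larger. -/
theorem lt_slotValue_of_first (hp : ∀ i, 0 < p i) (hsum : ∑ i, p i = 1) {i j : Fin k}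
    (hij : x i < x j) (hlh : x i < hi) (N n : ℕ) :
    x i < slotValue p x (x i) hi N (n + 1) := by
  induction N generalizing n with
  | zero => simpa [slotValue] using hlh
  | succ N ih =>
    have hm := slotValue_monotone (x := x) hp hsum hlh.le N
    have hlo := lo_le_slotValue (x := x) hp hsum hlh.le N
    rw [slotValue_succ]
    calc x i = ∑ j, p j * x i := by rw [← Finset.sum_mul, hsum, one_mul]
      _ < _ := Finset.sum_lt_sum
        (fun l _ => mul_le_mul_of_nonneg_left ((hlo n).trans (le_clamp _ _ _)) (hp l).le)
        ⟨j, Finset.mem_univ j, mul_lt_mul_of_pos_left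
          ((lt_min (ih n) hij).trans_le (min_le_clamp _ _ _)) (hp j)⟩

theorem slotValue_lt_of_last (hp : ∀ i, 0 < p i) (hsum : ∑ i, p i = 1) {i j : Fin k}
    (hij : x j < x i) (hlh : lo < x i) {N n : ℕ} (hn : n ≤ N) :
    slotValue p x lo (x i) N n < x i := by
  have h := lt_slotValue_of_first (p := fun j => p j.rev) (x := fun j => -x j.rev)
    (i := i.rev) (j := j.rev) (hi := -lo) (fun j => hp _)
    (by rw [← hsum]; exact Equiv.sum_comp Fin.revPerm p) (by simpa using hij) (by simpa using hlh)
    N (N - n)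
  rw [show -x i.rev.rev = -x i by rw [Fin.rev_rev], slotValue_rev hp hsum hlh.le (by omega),
    show N + 1 - (N - n + 1) = n by omega] at h
  linarith

end SlotValue

/-! ### The one-round placement problem. -/

section Placement

variable {α : Type*} [LinearOrder α]

/-- The position of `l` in the set `S`, counted from `1` in increasing order. -/
def slotRank (S : Finset α) (l : α) : ℕ := #{n ∈ S | n ≤ l}

theorem slotRank_pos {S : Finset α} {l : α} (hl : l ∈ S) : 0 < slotRank S l :=
  Finset.card_pos.2 ⟨l, by simp [hl]⟩

theorem slotRank_le_card (S : Finset α) (l : α) : slotRank S l ≤ #S :=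
  Finset.card_filter_le _ _

theorem slotRank_lt {S : Finset α} {l m : α} (hm : m ∈ S) (h : l < m) :
    slotRank S l < slotRank S m := by
  refine Finset.card_lt_card ⟨fun n hn => ?_, fun hs => ?_⟩
  · rw [Finset.mem_filter] at hn ⊢
    exact ⟨hn.1, hn.2.trans h.le⟩
  · have := hs (show m ∈ {n ∈ S | n ≤ m} by simp [hm])
    rw [Finset.mem_filter] at this
    exact absurd this.2 (not_le.2 h)

theorem slotRank_erase_of_lt {S : Finset α} {l m : α} (h : l < m) :
    slotRank (S.erase m) l = slotRank S l := by
  unfold slotRank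
  congr 1
  ext n
  simp only [Finset.mem_filter, Finset.mem_erase]
  constructor
  · rintro ⟨⟨-, h1⟩, h2⟩
    exact ⟨h1, h2⟩
  · rintro ⟨h1, h2⟩
    exact ⟨⟨(h2.trans_lt h).ne, h1⟩, h2⟩

theorem slotRank_erase_of_gt {S : Finset α} {l m : α} (hm : m ∈ S) (h : m < l) :
    slotRank (S.erase m) l = slotRank S l - 1 := by
  unfold slotRank
  rw [Finset.filter_erase, Finset.card_erase_of_mem (by simp [hm, h.le])]

theorem slotRank_insert_max {S : Finset α} {a l : α} (ha : ∀ b ∈ S, b < a) (hl : l ∈ S) :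
    slotRank (insert a S) l = slotRank S l := by
  unfold slotRank
  rw [Finset.filter_insert, if_neg (not_le.2 (ha l hl))]

theorem slotRank_insert_self {S : Finset α} {a : α} (ha : ∀ b ∈ S, b < a) :
    slotRank (insert a S) a = #S + 1 := by
  unfold slotRank
  rw [Finset.filter_true_of_mem, Finset.card_insert_of_notMem fun h => (ha a h).false]
  intro b hb
  rcases Finset.mem_insert.1 hb with rfl | hb
  · exact le_rfl
  · exact (ha b hb).le

theorem sum_slotRank (S : Finset α) (F : ℕ → ℝ) :
    ∑ l ∈ S, F (slotRank S l) = ∑ n ∈ range #S, F (n + 1) := by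
  induction S using Finset.induction_on_max with
  | empty => simp
  | insert a S ha ih =>
    have hn : a ∉ S := fun h => (ha a h).false
    rw [Finset.sum_insert hn, slotRank_insert_self ha, Finset.card_insert_of_notMem hn,
      Finset.sum_range_succ, ← ih, add_comm]
    congr 1
    exact Finset.sum_congr rfl fun l hl => by rw [slotRank_insert_max ha hl]

theorem exists_slotRank_eq (S : Finset α) {n : ℕ} (h0 : 0 < n) (hn : n ≤ #S) :
    ∃ l ∈ S, slotRank S l = n := by
  induction S using Finset.induction_on_max with
  | empty => simp at hn; omega
  | insert a S ha ih =>
    have hnot : a ∉ S := fun h => (ha a h).false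
    rw [Finset.card_insert_of_notMem hnot] at hn
    rcases Nat.lt_or_ge #S n with h | h
    · exact ⟨a, by simp, by rw [slotRank_insert_self ha]; omega⟩
    · obtain ⟨l, hl, h1⟩ := ih h
      exact ⟨l, by simp [hl], by rw [slotRank_insert_max ha hl, h1]⟩

theorem sum_clamp {v : ℕ → ℝ} (hv : Monotone v) (z : ℝ) (N : ℕ) :
    ∑ n ∈ range N, clamp z (v n) (v (n + 1)) + v 0 =
      clamp z (v 0) (v N) + ∑ n ∈ range N, v n := by
  induction N with
  | zero => simp [clamp]
  | succ N ih =>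
    rw [Finset.sum_range_succ, Finset.sum_range_succ]
    have := clamp_add_clamp (z := z) (hv (Nat.zero_le N)) (hv N.le_succ)
    linarith

/-- The value of placing `z` at `m`, when the value of the `n`-th remaining location
is `v n`. -/
noncomputable def placedValue (v : ℕ → ℝ) (r : α → ℝ) (S : Finset α) (z : ℝ) (m : α) : ℝ :=
  z * r m + ∑ l ∈ S.erase m, v (slotRank (S.erase m) l) * r l

/-- The value of placing `z` at the best location of `S`. -/
noncomputable def bestValue (v : ℕ → ℝ) (r : α → ℝ) (S : Finset α) (z : ℝ) : ℝ :=
  ∑ l ∈ S, clamp z (v (slotRank S l - 1)) (v (slotRank S l)) * r l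

variable {v : ℕ → ℝ} {r : α → ℝ} {S : Finset α} {z : ℝ} {m : α}

/-- The clamps over S and the values z, v 1, ..., v (#S - 1) have equal sums by telescoping. As the
total weight is conserved, `r m` may be subtracted from every reward, which removes the term of m.
-/
theorem bestValue_sub_placedValue (hv : Monotone v) (hm : m ∈ S) (h0 : v 0 ≤ z) (h1 : z ≤ v #S) :
    bestValue v r S z - placedValue v r S z m = ∑ l ∈ S.erase m,
      (clamp z (v (slotRank S l - 1)) (v (slotRank S l)) - v (slotRank (S.erase m) l)) *
        (r l - r m) ∧
    clamp z (v (slotRank S m - 1)) (v (slotRank S m)) - z = -∑ l ∈ S.erase m,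
      (clamp z (v (slotRank S l - 1)) (v (slotRank S l)) - v (slotRank (S.erase m) l)) := by
  have e1 := sum_slotRank S fun n => clamp z (v (n - 1)) (v n)
  have e2 := sum_slotRank (S.erase m) v
  obtain ⟨N, hN⟩ : ∃ N, #S = N + 1 := ⟨#S - 1, by have := Finset.card_pos.2 ⟨m, hm⟩; omega⟩
  have hN' : #(S.erase m) = N := by rw [Finset.card_erase_of_mem hm, hN]; rfl
  have e3 := sum_clamp hv z (N + 1)
  rw [← hN, (clamp_eq_self_iff (hv (Nat.zero_le _))).2 ⟨h0, h1⟩, hN, Finset.sum_range_succ' v,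
    ← hN', ← e2, hN', ← hN] at e3
  simp only [Nat.add_sub_cancel] at e1
  rw [← e1, ← Finset.add_sum_erase S _ hm] at e3
  have h2 : clamp z (v (slotRank S m - 1)) (v (slotRank S m)) - z = -∑ l ∈ S.erase m,
      (clamp z (v (slotRank S l - 1)) (v (slotRank S l)) - v (slotRank (S.erase m) l)) := by
    rw [Finset.sum_sub_distrib]
    linarith
  refine ⟨?_, h2⟩
  simp only [mul_sub, Finset.sum_sub_distrib, ← Finset.sum_mul]
  rw [bestValue, placedValue, ← Finset.add_sum_erase S _ hm]
  have h3 : ∑ l ∈ S.erase m, (clamp z (v (slotRank S l - 1)) (v (slotRank S l))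
      - v (slotRank (S.erase m) l)) * r l = ∑ l ∈ S.erase m,
      clamp z (v (slotRank S l - 1)) (v (slotRank S l)) * r l
      - ∑ l ∈ S.erase m, v (slotRank (S.erase m) l) * r l := by
    rw [← Finset.sum_sub_distrib]
    exact Finset.sum_congr rfl fun l _ => by ring
  rw [h3]
  rw [Finset.sum_sub_distrib] at h2
  linear_combination r m * h2

/-- Removing m keeps the ranks below m, where the clamp is at most its upper end, and lowers the
ranks above m by one, where the clamp is at least its lower end: both factors change sign at m. -/
theorem clamp_sub_mul_nonneg (hv : Monotone v) (hr : StrictMono r) (hm : m ∈ S) {l : α}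
    (hl : l ∈ S.erase m) :
    0 ≤ (clamp z (v (slotRank S l - 1)) (v (slotRank S l)) - v (slotRank (S.erase m) l)) *
      (r l - r m) := by
  rcases lt_or_gt_of_ne (Finset.ne_of_mem_erase hl) with h | h
  · rw [slotRank_erase_of_lt h]
    exact mul_nonneg_of_nonpos_of_nonpos
      (by linarith [clamp_le (hv (Nat.sub_le (slotRank S l) 1)) z]) (by linarith [hr h])
  · rw [slotRank_erase_of_gt hm h]
    exact mul_nonneg (by linarith [le_clamp z (v (slotRank S l - 1)) (v (slotRank S l))])
      (by linarith [hr h])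

theorem placedValue_le_bestValue (hv : Monotone v) (hr : StrictMono r) (hm : m ∈ S)
    (h0 : v 0 ≤ z) (h1 : z ≤ v #S) : placedValue v r S z m ≤ bestValue v r S z := by
  rw [← sub_nonneg, (bestValue_sub_placedValue hv hm h0 h1).1]
  exact Finset.sum_nonneg fun l hl => clamp_sub_mul_nonneg hv hr hm hl

theorem bestValue_sub_placedValue_eq_zero_iff (hv : Monotone v) (hr : StrictMono r) (hm : m ∈ S)
    (h0 : v 0 ≤ z) (h1 : z ≤ v #S) : bestValue v r S z - placedValue v r S z m = 0 ↔
      v (slotRank S m - 1) ≤ z ∧ z ≤ v (slotRank S m) := by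
  obtain ⟨e1, e2⟩ := bestValue_sub_placedValue (r := r) hv hm h0 h1
  rw [e1, Finset.sum_eq_zero_iff_of_nonneg fun l hl => clamp_sub_mul_nonneg hv hr hm hl]
  constructor
  · intro h
    rw [← clamp_eq_self_iff (hv (Nat.sub_le _ 1)), ← sub_eq_zero, e2, neg_eq_zero]
    refine Finset.sum_eq_zero fun l hl => ?_
    exact (mul_eq_zero.1 (h l hl)).resolve_right
      (sub_ne_zero.2 (hr.injective.ne (Finset.ne_of_mem_erase hl)))
  · rintro ⟨h2, h3⟩ l hl
    have hlS := Finset.mem_of_mem_erase hl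
    rw [mul_eq_zero, sub_eq_zero]
    left
    rcases lt_or_gt_of_ne (Finset.ne_of_mem_erase hl) with h | h
    · rw [slotRank_erase_of_lt h]
      have h4 : v (slotRank S l) ≤ z := (hv (by have := slotRank_lt hm h; omega)).trans h2
      rw [clamp, min_eq_left h4, max_eq_right (hv (Nat.sub_le _ 1))]
    · rw [slotRank_erase_of_gt hm h]
      have h4 : z ≤ v (slotRank S l - 1) := h3.trans (hv (by have := slotRank_lt hlS h; omega))
      rw [clamp, max_eq_left ((min_le_right _ _).trans h4)]

/-- Some location of `S` is a best place for `z`. -/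
theorem exists_best_slot (h0 : v 0 ≤ z) (h1 : z ≤ v #S) (hS : S.Nonempty) :
    ∃ m ∈ S, v (slotRank S m - 1) ≤ z ∧ z ≤ v (slotRank S m) := by
  classical
  rcases h0.eq_or_lt with h0' | h0'
  -- If z = v 0 the least n with z ≤ v n is 0, which is no position, so the search starts at 1.
  · have hex : ∃ n, 0 < n ∧ z ≤ v n := ⟨#S, Finset.card_pos.2 hS, h1⟩
    obtain ⟨h2, h3⟩ := Nat.find_spec hex
    obtain ⟨m, hm, hr⟩ := exists_slotRank_eq S h2 (Nat.find_min' hex ⟨Finset.card_pos.2 hS, h1⟩)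
    refine ⟨m, hm, ?_, by rwa [hr]⟩
    rw [hr]
    rcases Nat.eq_zero_or_pos (Nat.find hex - 1) with h4 | h4
    · rw [h4, h0']
    · have := Nat.find_min hex (show Nat.find hex - 1 < Nat.find hex by omega)
      push Not at this
      exact (this h4).le
  · have hex : ∃ n, z ≤ v n := ⟨#S, h1⟩
    have h2 := Nat.find_spec hex
    have h3 : Nat.find hex ≠ 0 := fun h => by
      rw [h] at h2
      exact absurd h2 (not_le.2 h0')
    obtain ⟨m, hm, hr⟩ := exists_slotRank_eq S (Nat.pos_of_ne_zero h3) (Nat.find_min' hex h1)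
    refine ⟨m, hm, ?_, by rwa [hr]⟩
    rw [hr]
    exact (not_le.1 (Nat.find_min hex (show Nat.find hex - 1 < Nat.find hex by omega))).le

variable {k : ℕ} {p x : Fin k → ℝ} {lo hi : ℝ}

/-- The expected reward of the threshold policy from the set `S` of empty locations. -/
noncomputable def continuationValue (p x : Fin k → ℝ) (lo hi : ℝ) (r : α → ℝ) (S : Finset α) : ℝ :=
  ∑ l ∈ S, slotValue p x lo hi #S (slotRank S l) * r l

theorem placedValue_eq (hm : m ∈ S) :
    placedValue (slotValue p x lo hi (#S - 1)) r S z m =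
      z * r m + continuationValue p x lo hi r (S.erase m) := by
  rw [placedValue, continuationValue, Finset.card_erase_of_mem hm]

/-- Bellman's equation: averaging over the next observation is the recursion of `slotValue`. -/
theorem sum_bestValue (r : α → ℝ) (S : Finset α) :
    ∑ j, p j * bestValue (slotValue p x lo hi (#S - 1)) r S (x j) =
      continuationValue p x lo hi r S := by
  unfold bestValue continuationValue
  simp only [Finset.mul_sum]
  rw [Finset.sum_comm]
  refine Finset.sum_congr rfl fun l hl => ?_
  have h1 := slotRank_pos hl
  have h2 := slotRank_le_card S l
  obtain ⟨N, hN⟩ : ∃ N, #S = N + 1 := ⟨#S - 1, by omega⟩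
  obtain ⟨n, hn⟩ : ∃ n, slotRank S l = n + 1 := ⟨slotRank S l - 1, by omega⟩
  rw [hN, hn, slotValue_succ, Finset.sum_mul]
  simp only [Nat.add_sub_cancel]
  exact Finset.sum_congr rfl fun j _ => by ring

end Placement

/-! ### Discrete samples, independence and expectations as finite sums. -/

section Sample

variable {k : ℕ} {p x : Fin k → ℝ} {Ω : Type*} [MeasurableSpace Ω] {P : Measure Ω}

theorem discreteLaw_singleton (hx : StrictMono x) (j : Fin k) :
    discreteLaw p x {x j} = ENNReal.ofReal (p j) := by
  rw [discreteLaw, Measure.finsetSum_apply]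
  rw [Finset.sum_eq_single j]
  · simp
  · intro i _ hij
    simp [hx.injective.ne hij]
  · simp

theorem discreteLaw_compl_range : discreteLaw p x (Set.range x)ᶜ = 0 := by
  rw [discreteLaw, Measure.finsetSum_apply]
  refine Finset.sum_eq_zero fun i _ => ?_
  simp [Measure.dirac_apply' _ (Set.finite_range x).measurableSet.compl]

namespace IsIIDSample

variable {ι : Type*} {X : ι → Ω → ℝ}

theorem ae_mem_range (h : IsIIDSample p x X P) (t : ι) : ∀ᵐ ω ∂P, X t ω ∈ Set.range x := by
  have h1 : P.map (X t) (Set.range x)ᶜ = 0 := by rw [h.law, discreteLaw_compl_range]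
  rwa [Measure.map_apply (h.measurable t) (Set.finite_range x).measurableSet.compl] at h1

theorem measureReal_eq (h : IsIIDSample p x X P) (hx : StrictMono x) (hp : ∀ i, 0 < p i) (t : ι)
    (j : Fin k) : P.real (X t ⁻¹' {x j}) = p j := by
  rw [measureReal_def, ← Measure.map_apply (h.measurable t) (measurableSet_singleton _), h.law,
    discreteLaw_singleton hx, ENNReal.toReal_ofReal (hp j).le]

theorem indepFun_of_measurable [IsProbabilityMeasure P] (h : IsIIDSample p x X P) {t : ι}
    {s : Set ι} (hts : t ∉ s) {β : Type*} [MeasurableSpace β] {Y : Ω → β}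
    (hY : Measurable[⨆ i ∈ s, MeasurableSpace.comap (X i) inferInstance] Y) :
    IndepFun Y (X t) P := by
  have h1 := indep_iSup_of_disjoint (fun i => (h.measurable i).comap_le) h.indep
    (Set.disjoint_singleton_right.2 hts)
  rw [IndepFun_iff_Indep]
  refine indep_of_indep_of_le_left (indep_of_indep_of_le_right h1 ?_) hY.comap_le
  simp

end IsIIDSample

theorem ae_eq_sum_indicator {β : Type*} [Fintype β] (hx : StrictMono x) {Z : Ω → ℝ}
    (hZ : ∀ᵐ ω ∂P, Z ω ∈ Set.range x) (Y : Ω → β) (F : β → ℝ → ℝ) :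
    (fun ω => F (Y ω) (Z ω)) =ᵐ[P]
      fun ω => ∑ y, ∑ j, (Y ⁻¹' {y} ∩ Z ⁻¹' {x j}).indicator (fun _ => F y (x j)) ω := by
  filter_upwards [hZ] with ω ⟨j, hj⟩
  rw [Finset.sum_eq_single (Y ω), Finset.sum_eq_single j]
  · simp [← hj]
  · intro i _ hi
    rw [Set.indicator_of_notMem]
    simp only [Set.mem_inter_iff, Set.mem_preimage, Set.mem_singleton_iff, not_and, ← hj]
    exact fun _ => hx.injective.ne hi.symm
  · simp
  · intro y _ hy
    refine Finset.sum_eq_zero fun i _ => ?_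
    rw [Set.indicator_of_notMem]
    simp only [Set.mem_inter_iff, Set.mem_preimage, Set.mem_singleton_iff, not_and]
    exact fun h => absurd h.symm hy
  · simp

theorem integrable_comp_finite {β : Type*} [Finite β] [MeasurableSpace β]
    [MeasurableSingletonClass β] [IsProbabilityMeasure P] (hx : StrictMono x) {Z : Ω → ℝ}
    (hZm : Measurable Z) (hZ : ∀ᵐ ω ∂P, Z ω ∈ Set.range x) {Y : Ω → β} (hY : Measurable Y)
    (F : β → ℝ → ℝ) : Integrable (fun ω => F (Y ω) (Z ω)) P := by
  have := Fintype.ofFinite β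
  refine Integrable.congr ?_ (ae_eq_sum_indicator hx hZ Y F).symm
  refine integrable_finsetSum _ fun y _ => integrable_finsetSum _ fun j _ => ?_
  exact (integrable_const _).indicator
    ((hY (measurableSet_singleton y)).inter (hZm (measurableSet_singleton _)))

theorem integral_comp_finite {β : Type*} [Fintype β] [MeasurableSpace β]
    [MeasurableSingletonClass β] [IsProbabilityMeasure P] {Y : Ω → β} (hY : Measurable Y)
    (F : β → ℝ) : ∫ ω, F (Y ω) ∂P = ∑ y, P.real (Y ⁻¹' {y}) * F y := by
  have h : (fun ω => F (Y ω)) = fun ω => ∑ y, (Y ⁻¹' {y}).indicator (fun _ => F y) ω := by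
    funext ω
    rw [Finset.sum_eq_single (Y ω)]
    · simp
    · intro y _ hy
      rw [Set.indicator_of_notMem]
      exact fun h => hy h.symm
    · simp
  rw [h, integral_finsetSum _ fun y _ =>
    (integrable_const _).indicator (hY (measurableSet_singleton y))]
  refine Finset.sum_congr rfl fun y _ => ?_
  rw [integral_indicator_const _ (hY (measurableSet_singleton y)), smul_eq_mul]

theorem integral_comp_indep {β : Type*} [Finite β] [MeasurableSpace β]
    [MeasurableSingletonClass β] [IsProbabilityMeasure P] {ι : Type*} {X : ι → Ω → ℝ}
    (h : IsIIDSample p x X P) (hx : StrictMono x) (hp : ∀ i, 0 < p i) {t : ι} {Y : Ω → β}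
    (hY : Measurable Y) (hind : IndepFun Y (X t) P) (F : β → ℝ → ℝ) :
    ∫ ω, F (Y ω) (X t ω) ∂P = ∫ ω, ∑ j, p j * F (Y ω) (x j) ∂P := by
  have := Fintype.ofFinite β
  have hX := h.measurable t
  rw [integral_congr_ae (ae_eq_sum_indicator hx (h.ae_mem_range t) Y F),
    integral_comp_finite hY fun y => ∑ j, p j * F y (x j)]
  have hms : ∀ y j, MeasurableSet (Y ⁻¹' {y} ∩ X t ⁻¹' {x j}) := fun y j =>
    (hY (measurableSet_singleton y)).inter (hX (measurableSet_singleton _))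
  rw [integral_finsetSum _ fun y _ => integrable_finsetSum _ fun j _ =>
    (integrable_const _).indicator (hms y j)]
  refine Finset.sum_congr rfl fun y _ => ?_
  rw [integral_finsetSum _ fun j _ => (integrable_const _).indicator (hms y j), Finset.mul_sum]
  refine Finset.sum_congr rfl fun j _ => ?_
  rw [integral_indicator_const _ (hms y j), smul_eq_mul, measureReal_def,
    hind.measure_inter_preimage_eq_mul _ _ (measurableSet_singleton y) (measurableSet_singleton _),
    ENNReal.toReal_mul, ← measureReal_def, ← measureReal_def, h.measureReal_eq hx hp]
  ring

end Sample

/-! ### Policies, regret and optimality. -/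

section Policy

variable {M : ℕ} {Ω : Type*}

/-- The locations that are empty before round `t`. -/
def emptySlots (J : Fin M → Ω → Fin M) (t : ℕ) (ω : Ω) : Finset (Fin M) :=
  {n | ∀ s : Fin M, (s : ℕ) < t → J s ω ≠ n}

theorem chosenPosition_eq (J : Fin M → Ω → Fin M) (t : Fin M) (ω : Ω) :
    chosenPosition J t ω = slotRank (emptySlots J t ω) (J t ω) := by
  unfold chosenPosition slotRank emptySlots
  congr 1
  ext n
  simp only [Finset.mem_filter, Finset.mem_univ, true_and]
  rw [and_comm]
  rfl

theorem emptySlots_zero (J : Fin M → Ω → Fin M) (ω : Ω) : emptySlots J 0 ω = univ := by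
  simp [emptySlots]

theorem emptySlots_succ (J : Fin M → Ω → Fin M) (t : Fin M) (ω : Ω) :
    emptySlots J (t + 1) ω = (emptySlots J t ω).erase (J t ω) := by
  ext n
  simp only [emptySlots, Finset.mem_filter, Finset.mem_univ, true_and, Finset.mem_erase]
  constructor
  · intro h
    exact ⟨(h t (Nat.lt_succ_self _)).symm, fun s hs => h s (by omega)⟩
  · rintro ⟨h1, h2⟩ s hs
    rcases Nat.lt_succ_iff_lt_or_eq.1 hs with h | h
    · exact h2 s h
    · rw [Fin.ext h]
      exact h1.symm

variable {X : Fin M → Ω → ℝ} {J : Fin M → Ω → Fin M}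

theorem IsPolicy.mem_emptySlots (hJ : IsPolicy X J) (t : Fin M) (ω : Ω) :
    J t ω ∈ emptySlots J t ω := by
  simp only [emptySlots, Finset.mem_filter, Finset.mem_univ, true_and]
  intro s hs h
  have : s = t := hJ.distinct ω h
  rw [this] at hs
  exact lt_irrefl _ hs

theorem IsPolicy.card_emptySlots (hJ : IsPolicy X J) {t : ℕ} (ht : t ≤ M) (ω : Ω) :
    #(emptySlots J t ω) = M - t := by
  induction t with
  | zero => simp [emptySlots_zero]
  | succ t ih =>
    have h := emptySlots_succ J ⟨t, ht⟩ ω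
    have h2 := hJ.mem_emptySlots ⟨t, ht⟩ ω
    dsimp only at h h2
    rw [h, Finset.card_erase_of_mem h2, ih (by omega)]
    omega

/-- The locations chosen before round `t`. -/
def past (J : Fin M → Ω → Fin M) (t : ℕ) (ω : Ω) (s : {s : Fin M // (s : ℕ) < t}) : Fin M :=
  J s ω

/-- The locations not chosen in the past `y`. -/
def remaining {t : ℕ} (y : {s : Fin M // (s : ℕ) < t} → Fin M) : Finset (Fin M) :=
  {n | ∀ s, y s ≠ n}

theorem remaining_past (J : Fin M → Ω → Fin M) (t : ℕ) (ω : Ω) :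
    remaining (past J t ω) = emptySlots J t ω := by
  ext n
  simp [remaining, past, emptySlots]

/-- Only rounds strictly before t enter, which makes the set of empty locations independent of the
observation in round t. -/
theorem IsPolicy.measurable_past (hJ : IsPolicy X J) (t : ℕ) :
    Measurable[⨆ i ∈ {s : Fin M | (s : ℕ) < t}, MeasurableSpace.comap (X i) inferInstance]
      (past J t) := by
  refine @measurable_pi_lambda _ _ _ (_) _ _ fun s => ?_
  refine (hJ.adapted s).mono ?_ le_rfl
  refine iSup₂_le fun i hi => ?_
  exact le_iSup₂_of_le i (show (i : ℕ) < t from lt_of_le_of_lt hi s.2) le_rfl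

theorem IsPolicy.chosenPosition_mem (hJ : IsPolicy X J) (t : Fin M) (ω : Ω) :
    0 < chosenPosition J t ω ∧ chosenPosition J t ω ≤ M - t := by
  rw [chosenPosition_eq, ← hJ.card_emptySlots t.2.le ω]
  exact ⟨slotRank_pos (hJ.mem_emptySlots t ω), slotRank_le_card _ _⟩

/-- The locations that are empty before round `t` if the observation `o s` of each earlier round
`s` is placed at `G S (o s)`, where `S` is the set of locations empty at that time. -/
def ruleState (G : Finset (Fin M) → ℕ → Fin M) (o : ℕ → ℕ) : ℕ → Finset (Fin M)
  | 0 => univ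
  | t + 1 => (ruleState G o t).erase (G (ruleState G o t) (o t))

theorem emptySlots_ruleState (G : Finset (Fin M) → ℕ → Fin M) (o : Ω → ℕ → ℕ) {t : ℕ}
    (ht : t ≤ M) (ω : Ω) :
    emptySlots (fun (s : Fin M) ω => G (ruleState G (o ω) s) (o ω s)) t ω =
      ruleState G (o ω) t := by
  induction t with
  | zero => rw [emptySlots_zero, ruleState]
  | succ t ih =>
    have h := emptySlots_succ (fun (s : Fin M) ω => G (ruleState G (o ω) s) (o ω s)) ⟨t, ht⟩ ω
    dsimp only at h
    rw [h, ih (by omega), ruleState]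

/-- A choice rule gives a policy. -/
theorem isPolicy_ruleState {G : Finset (Fin M) → ℕ → Fin M}
    (hG : ∀ S, S.Nonempty → ∀ n, G S n ∈ S) {o : Ω → ℕ → ℕ}
    (ho : ∀ t : Fin M, Measurable[MeasurableSpace.comap (X t) inferInstance] fun ω => o ω t) :
    IsPolicy X fun (s : Fin M) ω => G (ruleState G (o ω) s) (o ω s) := by
  -- With the discrete σ-algebra on the states every choice rule is measurable.
  let : MeasurableSpace (Finset (Fin M)) := ⊤
  have : DiscreteMeasurableSpace (Finset (Fin M)) := ⟨fun _ => trivial⟩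
  have hcard : ∀ (ω : Ω) (t : ℕ), t ≤ M → #(ruleState G (o ω) t) = M - t := by
    intro ω t
    induction t with
    | zero => simp [ruleState]
    | succ t ih =>
      intro ht
      have h := ih (by omega)
      rw [ruleState, Finset.card_erase_of_mem (hG _ (Finset.card_pos.1 (by omega)) _), h]
      omega
  have hmem : ∀ (ω : Ω) (t : Fin M), G (ruleState G (o ω) t) (o ω t) ∈ ruleState G (o ω) t := by
    intro ω t
    have h := hcard ω t t.2.le
    exact hG _ (Finset.card_pos.1 (by omega)) _
  refine ⟨fun t => ?_, fun ω => ?_⟩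
  · have hobs : ∀ s : Fin M, s ≤ t → Measurable[history X t] fun ω => o ω s := fun s hs =>
      (ho s).mono (le_iSup₂_of_le s hs le_rfl) le_rfl
    have hstate : ∀ n : ℕ, n ≤ t → Measurable[history X t] fun ω => ruleState G (o ω) n := by
      intro n
      induction n with
      | zero =>
        intro _
        simp only [ruleState]
        exact @measurable_const _ _ _ (_) _
      | succ n ih =>
        intro hn
        have h1 := @Measurable.prodMk _ _ _ _ _ (_) _ _ (ih (by omega))
          (hobs ⟨n, by omega⟩ (by rw [Fin.le_def]; dsimp only; omega))
        exact (Measurable.of_discrete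
          (f := fun y : Finset (Fin M) × ℕ => y.1.erase (G y.1 y.2))).comp h1
    have h1 := @Measurable.prodMk _ _ _ _ _ (_) _ _ (hstate t le_rfl) (hobs t le_rfl)
    exact (Measurable.of_discrete (f := fun y : Finset (Fin M) × ℕ => G y.1 y.2)).comp h1
  · have hne : ∀ s t : Fin M, s < t →
        G (ruleState G (o ω) s) (o ω s) ≠ G (ruleState G (o ω) t) (o ω t) := by
      intro s t hst h
      have h1 : G (ruleState G (o ω) t) (o ω t) ∈
          emptySlots (fun (s : Fin M) ω => G (ruleState G (o ω) s) (o ω s)) t ω := by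
        rw [emptySlots_ruleState G o t.2.le ω]
        exact hmem ω t
      exact (Finset.mem_filter.1 h1).2 s hst h
    intro s t h
    by_contra hst
    rcases lt_or_gt_of_ne hst with h1 | h1
    · exact hne s t h1 h
    · exact hne t s h1 h.symm

variable [MeasurableSpace Ω] {P : Measure Ω}
  {k : ℕ} {p x : Fin k → ℝ} {lo hi : ℝ} {r : Fin M → ℝ}

theorem IsPolicy.measurable_past_ambient (hX : IsIIDSample p x X P) (hJ : IsPolicy X J) (t : ℕ) :
    Measurable (past J t) :=
  (hJ.measurable_past t).mono (iSup₂_le fun i _ => (hX.measurable i).comap_le) le_rfl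

/-- The loss of value by the placement in round `t`, relative to the best placement. -/
noncomputable def regret (p x : Fin k → ℝ) (lo hi : ℝ) (X : Fin M → Ω → ℝ) (r : Fin M → ℝ)
    (J : Fin M → Ω → Fin M) (t : Fin M) (ω : Ω) : ℝ :=
  bestValue (slotValue p x lo hi (#(emptySlots J t ω) - 1)) r (emptySlots J t ω) (X t ω) -
    placedValue (slotValue p x lo hi (#(emptySlots J t ω) - 1)) r (emptySlots J t ω) (X t ω)
      (J t ω)

theorem regret_nonneg (hp : ∀ i, 0 < p i) (hsum : ∑ i, p i = 1)
    (hlo : ∀ j, lo ≤ x j) (hhi : ∀ j, x j ≤ hi) (hr : StrictMono r) (hX : IsIIDSample p x X P)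
    (hJ : IsPolicy X J) (t : Fin M) : ∀ᵐ ω ∂P, 0 ≤ regret p x lo hi X r J t ω ∧
      (regret p x lo hi X r J t ω = 0 ↔
        slotValue p x lo hi (M - t - 1) (chosenPosition J t ω - 1) ≤ X t ω ∧
        X t ω ≤ slotValue p x lo hi (M - t - 1) (chosenPosition J t ω)) := by
  filter_upwards [hX.ae_mem_range t] with ω ⟨j, hj⟩
  have hm := hJ.mem_emptySlots t ω
  have hc := Finset.card_pos.2 ⟨_, hm⟩
  have hv := slotValue_monotone (x := x) hp hsum ((hlo j).trans (hhi j))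
    (#(emptySlots J t ω) - 1)
  have h0 : slotValue p x lo hi (#(emptySlots J t ω) - 1) 0 ≤ X t ω := by
    rw [slotValue_zero, ← hj]
    exact hlo j
  have h1 : X t ω ≤ slotValue p x lo hi (#(emptySlots J t ω) - 1) #(emptySlots J t ω) := by
    rw [slotValue_of_lt hsum (by omega), ← hj]
    exact hhi j
  refine ⟨sub_nonneg.2 (placedValue_le_bestValue hv hr hm h0 h1), ?_⟩
  rw [regret, bestValue_sub_placedValue_eq_zero_iff hv hr hm h0 h1, chosenPosition_eq,
    hJ.card_emptySlots t.2.le]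

theorem integrable_past [IsProbabilityMeasure P] (hx : StrictMono x) (hX : IsIIDSample p x X P)
    (hJ : IsPolicy X J) (t : Fin M) (F : Finset (Fin M) → Fin M → ℝ → ℝ) :
    Integrable (fun ω => F (emptySlots J t ω) (J t ω) (X t ω)) P := by
  have hJm : Measurable (J t) :=
    (hJ.adapted t).mono (iSup₂_le fun i _ => (hX.measurable i).comap_le) le_rfl
  have h := integrable_comp_finite hx (hX.measurable t) (hX.ae_mem_range t)
    ((hJ.measurable_past_ambient hX t).prodMk hJm) fun y z => F (remaining y.1) y.2 z
  simpa only [remaining_past] using h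

theorem integrable_regret [IsProbabilityMeasure P] (hx : StrictMono x) (hX : IsIIDSample p x X P)
    (hJ : IsPolicy X J) (t : Fin M) : Integrable (regret p x lo hi X r J t) P :=
  integrable_past hx hX hJ t fun S m z =>
    bestValue (slotValue p x lo hi (#S - 1)) r S z -
      placedValue (slotValue p x lo hi (#S - 1)) r S z m

/-- Each reward is a drop in continuation value minus a regret, because the best value averages to
the continuation value; summing over rounds telescopes. -/
theorem integral_round [IsProbabilityMeasure P] (hp : ∀ i, 0 < p i) (hx : StrictMono x)
    (hX : IsIIDSample p x X P) (hJ : IsPolicy X J) (t : Fin M) :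
    ∫ ω, X t ω * r (J t ω) ∂P =
      ∫ ω, continuationValue p x lo hi r (emptySlots J t ω) ∂P -
      ∫ ω, continuationValue p x lo hi r (emptySlots J (t + 1) ω) ∂P -
      ∫ ω, regret p x lo hi X r J t ω ∂P := by
  have h1 : ∫ ω, bestValue (slotValue p x lo hi (#(emptySlots J t ω) - 1)) r (emptySlots J t ω)
      (X t ω) ∂P = ∫ ω, continuationValue p x lo hi r (emptySlots J t ω) ∂P := by
    have hind := hX.indepFun_of_measurable (t := t) (s := {s : Fin M | (s : ℕ) < t}) (by simp)
      (hJ.measurable_past t)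
    have h := integral_comp_indep hX hx hp (hJ.measurable_past_ambient hX t) hind fun y z =>
      bestValue (slotValue p x lo hi (#(remaining y) - 1)) r (remaining y) z
    simpa only [remaining_past, sum_bestValue] using h
  have h2 : ∀ ω, regret p x lo hi X r J t ω =
      bestValue (slotValue p x lo hi (#(emptySlots J t ω) - 1)) r (emptySlots J t ω) (X t ω) -
      (X t ω * r (J t ω) + continuationValue p x lo hi r (emptySlots J (t + 1) ω)) := fun ω => by
    rw [regret, placedValue_eq (hJ.mem_emptySlots t ω), emptySlots_succ]
  have i1 := integrable_past hx hX hJ t fun S _ z =>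
    bestValue (slotValue p x lo hi (#S - 1)) r S z
  have i2 := integrable_past hx hX hJ t fun _ m z => z * r m
  have i3 := integrable_past hx hX hJ t fun S m _ => continuationValue p x lo hi r (S.erase m)
  simp only [← emptySlots_succ] at i3
  simp only [h2]
  rw [integral_sub i1 (by exact i2.add i3), integral_add i2 i3, h1]
  ring

/-- The expected reward of a policy is the value of the threshold policy minus the expected
regrets. -/
theorem integral_reward [IsProbabilityMeasure P] (hp : ∀ i, 0 < p i) (hx : StrictMono x)
    (hX : IsIIDSample p x X P) (hJ : IsPolicy X J) :
    ∫ ω, reward X r J ω ∂P = continuationValue p x lo hi r univ -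
      ∑ t, ∫ ω, regret p x lo hi X r J t ω ∂P := by
  unfold reward
  rw [integral_finsetSum _ fun t _ => integrable_past hx hX hJ t fun _ m z => z * r m]
  simp only [integral_round (lo := lo) (hi := hi) hp hx hX hJ, Finset.sum_sub_distrib]
  rw [← Finset.sum_sub_distrib,
    Fin.sum_univ_eq_sum_range (fun t => ∫ ω, continuationValue p x lo hi r (emptySlots J t ω) ∂P -
      ∫ ω, continuationValue p x lo hi r (emptySlots J (t + 1) ω) ∂P) M, Finset.sum_range_sub']
  have h : ∀ ω, emptySlots J M ω = ∅ := fun ω => by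
    rw [← Finset.card_eq_zero, hJ.card_emptySlots le_rfl, Nat.sub_self]
  simp [emptySlots_zero, h, continuationValue]

theorem card_lt_eq (hx : StrictMono x) (i : Fin k) : #{j | x j < x i} = (i : ℕ) := by
  have : (univ.filter fun j => x j < x i) = Finset.Iio i := by
    ext j
    simp [hx.lt_iff_lt]
  rw [this, Fin.card_Iio]

/-- Some policy has no regret. -/
theorem exists_policy_regret_eq_zero [IsProbabilityMeasure P] (hp : ∀ i, 0 < p i)
    (hsum : ∑ i, p i = 1) (hx : StrictMono x) (hlo : ∀ j, lo ≤ x j) (hhi : ∀ j, x j ≤ hi)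
    (hr : StrictMono r) (hX : IsIIDSample p x X P) :
    ∃ J : Fin M → Ω → Fin M, IsPolicy X J ∧ ∀ t, ∀ᵐ ω ∂P, regret p x lo hi X r J t ω = 0 := by
  -- A function on `Fin M` is chosen rather than a location, so that a choice exists also when `Fin
  -- M` is empty.
  have hex : ∀ (S : Finset (Fin M)) (n : ℕ), ∃ m : Fin M → Fin M, ∀ hS : S.Nonempty,
      m hS.choose ∈ S ∧ ∀ h : n < k,
        slotValue p x lo hi (#S - 1) (slotRank S (m hS.choose) - 1) ≤ x ⟨n, h⟩ ∧
        x ⟨n, h⟩ ≤ slotValue p x lo hi (#S - 1) (slotRank S (m hS.choose)) := by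
    intro S n
    by_cases hS : S.Nonempty
    · by_cases h : n < k
      · obtain ⟨m, hm, h1⟩ := exists_best_slot (v := slotValue p x lo hi (#S - 1)) (z := x ⟨n, h⟩)
          (by rw [slotValue_zero]; exact hlo _)
          (by
            rw [slotValue_of_lt hsum (by have := Finset.card_pos.2 hS; omega)]
            exact hhi _) hS
        exact ⟨fun _ => m, fun _ => ⟨hm, fun _ => h1⟩⟩
      · exact ⟨id, fun hS => ⟨hS.choose_spec, fun h' => absurd h' h⟩⟩
    · exact ⟨id, fun h => absurd h hS⟩
  rcases Nat.eq_zero_or_pos M with rfl | hM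
  · exact ⟨fun t _ => t, ⟨fun t => t.elim0, fun _ t => t.elim0⟩, fun t => t.elim0⟩
  choose G' hG' using hex
  classical
  let G : Finset (Fin M) → ℕ → Fin M := fun S n =>
    if hS : S.Nonempty then G' S n hS.choose else ⟨0, hM⟩
  have hG : ∀ S, S.Nonempty → ∀ n, G S n ∈ S := fun S hS n => by
    simp only [G, dif_pos hS]
    exact (hG' S n hS).1
  -- Counting the smaller support points recovers the index of the observed value as a measurable
  -- function of it.
  let o : Ω → ℕ → ℕ := fun ω t => if h : t < M then #{j | x j < X ⟨t, h⟩ ω} else 0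
  have hcount : Measurable fun z : ℝ => #{j | x j < z} := by
    simp only [Finset.card_filter]
    exact Finset.measurable_sum _ fun j _ =>
      Measurable.ite measurableSet_Ioi measurable_const measurable_const
  have ho : ∀ t : Fin M, Measurable[MeasurableSpace.comap (X t) inferInstance] fun ω => o ω t := by
    intro t
    have : (fun ω => o ω t) = (fun z : ℝ => #{j | x j < z}) ∘ X t := by
      funext ω
      simp [o]
    rw [this]
    exact hcount.comp (comap_measurable (X t))
  have hpol := isPolicy_ruleState hG ho
  refine ⟨_, hpol, fun t => ?_⟩
  filter_upwards [regret_nonneg hp hsum hlo hhi hr hX hpol t, hX.ae_mem_range t] with ω h ⟨i, hi⟩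
  rw [h.2, chosenPosition_eq, emptySlots_ruleState G o t.2.le]
  have hcard := hpol.card_emptySlots t.2.le ω
  rw [emptySlots_ruleState G o t.2.le] at hcard
  have hS : (ruleState G (o ω) t).Nonempty := Finset.card_pos.1 (by omega)
  have hoi : o ω t = i := by
    simp only [o, dif_pos t.2, Fin.eta, ← hi]
    exact card_lt_eq hx i
  have h1 := (hG' (ruleState G (o ω) t) (o ω t) hS).2 (by rw [hoi]; exact i.2)
  rw [hcard] at h1
  simp only [G, dif_pos hS]
  have e : x ⟨o ω t, by rw [hoi]; exact i.2⟩ = X t ω := by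
    rw [← hi]
    congr 1
    exact Fin.ext hoi
  rwa [e] at h1

/-- An optimal policy places the observed value between two consecutive slot values. -/
theorem IsOptimal.slotValue_le [IsProbabilityMeasure P] (hp : ∀ i, 0 < p i)
    (hsum : ∑ i, p i = 1) (hx : StrictMono x) (hlo : ∀ j, lo ≤ x j) (hhi : ∀ j, x j ≤ hi)
    (hr : StrictMono r) (hX : IsIIDSample p x X P) (hJ : IsOptimal P X r J) (t : Fin M) : ∀ᵐ ω ∂P,
      slotValue p x lo hi (M - t - 1) (chosenPosition J t ω - 1) ≤ X t ω ∧
      X t ω ≤ slotValue p x lo hi (M - t - 1) (chosenPosition J t ω) := by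
  obtain ⟨J', hJ', h0⟩ := exists_policy_regret_eq_zero hp hsum hx hlo hhi hr hX
  have h1 := hJ.2 J' hJ'
  rw [integral_reward (lo := lo) (hi := hi) hp hx hX hJ',
    integral_reward (lo := lo) (hi := hi) hp hx hX hJ.1,
    Finset.sum_eq_zero fun t _ => integral_eq_zero_of_ae (h0 t)] at h1
  have h2 : ∀ t, 0 ≤ᵐ[P] regret p x lo hi X r J t := fun t =>
    (regret_nonneg hp hsum hlo hhi hr hX hJ.1 t).mono fun ω h => h.1
  have h3 : ∫ ω, regret p x lo hi X r J t ω ∂P = 0 := by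
    have h4 := Finset.single_le_sum (f := fun t => ∫ ω, regret p x lo hi X r J t ω ∂P)
      (fun t _ => integral_nonneg_of_ae (h2 t)) (Finset.mem_univ t)
    have h5 := integral_nonneg_of_ae (h2 t)
    linarith
  rw [integral_eq_zero_iff_of_nonneg_ae (h2 t) (integrable_regret hx hX hJ.1 t)] at h3
  filter_upwards [h3, regret_nonneg hp hsum hlo hhi hr hX hJ.1 t] with ω h4 h5
  exact h5.2.1 h4

end Policy

/-! ### Large deviations of the counts of observations. -/

section Tails

variable {k : ℕ} {p x : Fin k → ℝ} {Ω : Type*} [MeasurableSpace Ω] {P : Measure Ω}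

theorem IsIIDSample.measureReal_setOf {ι : Type*} {X : ι → Ω → ℝ} (h : IsIIDSample p x X P)
    (hp : ∀ i, 0 < p i) {s : ℝ → Prop} [DecidablePred s] (hs : MeasurableSet {z | s z}) (t : ι) :
    P.real {ω | s (X t ω)} = ∑ j with s (x j), p j := by
  have h1 : {ω | s (X t ω)} = X t ⁻¹' {z | s z} := rfl
  rw [h1, measureReal_def, ← Measure.map_apply (h.measurable t) hs, h.law, discreteLaw,
    Measure.finsetSum_apply, ENNReal.toReal_sum, Finset.sum_filter]
  · refine Finset.sum_congr rfl fun j _ => ?_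
    rw [Measure.smul_apply, Measure.dirac_apply' _ hs]
    by_cases hj : s (x j) <;> simp [hj, (hp j).le]
  · intro j _
    rw [Measure.smul_apply, Measure.dirac_apply' _ hs]
    by_cases hj : s (x j) <;> simp [hj]

/-- The large-deviation limit of the number of observations with the property `s`. -/
theorem IsIIDSample.tendsto_log_tail [IsProbabilityMeasure P] {X : ℕ → Ω → ℝ}
    (h : IsIIDSample p x X P) (hp : ∀ i, 0 < p i) {s : ℝ → Prop} [DecidablePred s]
    (hs : MeasurableSet {z | s z}) {q y : ℝ} (hq : ∑ j with s (x j), p j = q) (hq0 : 0 < q)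
    (hqy : q < y) (hy : y < 1) :
    Tendsto (fun N : ℕ => -(1 / (N : ℝ) *
      Real.log (P.real {ω | y * N ≤ (#{t ∈ range N | s (X t ω)} : ℝ)}))) atTop
      (𝓝 (binomialRate q y)) := by
  have hmeas : ∀ N, Measurable[⨆ i ∈ {i : ℕ | i < N}, MeasurableSpace.comap (X i) inferInstance]
      fun ω => #{t ∈ range N | s (X t ω)} := by
    intro N
    simp only [Finset.card_filter]
    refine Finset.measurable_sum _ fun t ht => ?_
    have h1 : Measurable fun z : ℝ => if s z then 1 else 0 :=
      Measurable.ite hs measurable_const measurable_const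
    refine (h1.comp (comap_measurable (X t))).mono ?_ le_rfl
    exact le_iSup₂_of_le t (show t < N from Finset.mem_range.1 ht) le_rfl
  have hmeas' : ∀ N, Measurable fun ω => #{t ∈ range N | s (X t ω)} := fun N =>
    (hmeas N).mono (iSup₂_le fun i _ => (h.measurable i).comap_le) le_rfl
  have hXs : ∀ N, MeasurableSet {ω | s (X N ω)} := fun N => h.measurable N hs
  have hcount : ∀ N n, MeasurableSet {ω | n ≤ #{t ∈ range N | s (X t ω)}} := fun N n =>
    hmeas' N measurableSet_Ici
  have hind : ∀ N, IndepFun (fun ω => #{t ∈ range N | s (X t ω)}) (X N) P := fun N =>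
    h.indepFun_of_measurable (s := {i : ℕ | i < N}) (by simp) (hmeas N)
  -- Conditioning on the last observation, which is independent of the earlier count, gives the
  -- binomial recursion.
  have key := tendsto_binomialTail (w := fun N n => P.real {ω | n ≤ #{t ∈ range N | s (X t ω)}})
    hq0 hqy hy (by simp) (by simp) (fun _ _ => measureReal_nonneg) fun N n => by
      have hcard : ∀ ω, #{t ∈ range (N + 1) | s (X t ω)} =
          (if s (X N ω) then 1 else 0) + #{t ∈ range N | s (X t ω)} := fun ω => by
        rw [Finset.card_filter, Finset.sum_range_succ, add_comm, ← Finset.card_filter]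
      have hset : {ω | n + 1 ≤ #{t ∈ range (N + 1) | s (X t ω)}} =
          ({ω | n ≤ #{t ∈ range N | s (X t ω)}} ∩ {ω | s (X N ω)}) ∪
          ({ω | n + 1 ≤ #{t ∈ range N | s (X t ω)}} ∩ {ω | s (X N ω)}ᶜ) := by
        ext ω
        simp only [Set.mem_ofPred_eq, Set.mem_union, Set.mem_inter_iff, Set.mem_compl_iff, hcard]
        by_cases hsω : s (X N ω)
        · simp only [hsω, if_true, not_true_eq_false, and_true, and_false, or_false]
          omega
        · simp [hsω]
      have hprod : ∀ (m : ℕ) (B : Set ℝ), MeasurableSet B →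
          P.real ({ω | m ≤ #{t ∈ range N | s (X t ω)}} ∩ X N ⁻¹' B) =
          P.real {ω | m ≤ #{t ∈ range N | s (X t ω)}} * P.real (X N ⁻¹' B) := fun m B hB => by
        rw [measureReal_def, measureReal_def, measureReal_def, ← ENNReal.toReal_mul]
        congr 1
        exact (hind N).measure_inter_preimage_eq_mul (Set.Ici m) B measurableSet_Ici hB
      have hqN := (h.measureReal_setOf hp hs N).trans hq
      have h1 := hprod n {z | s z} hs
      have h2 := hprod (n + 1) {z | s z}ᶜ hs.compl
      have h3 : P.real (X N ⁻¹' {z | s z}ᶜ) = 1 - q := by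
        rw [← hqN]
        exact probReal_compl_eq_one_sub (hXs N)
      have h4 : P.real (X N ⁻¹' {z | s z}) = q := hqN
      rw [h3] at h2
      rw [h4] at h1
      rw [hset, measureReal_union (Set.disjoint_left.2 fun ω ha hb => hb.2 ha.2)
        ((hcount N _).inter (hXs N).compl)]
      refine (congrArg₂ (· + ·) h1 h2).trans ?_
      ring
  refine key.congr fun N => ?_
  simp only [Nat.ceil_le]

end Tails

/-! ### From the crossing slope to the asymptotics of optimal positions. -/

section Asymptotics

variable {k : ℕ} {p x : Fin k → ℝ} {lo hi : ℝ}

theorem limitLocation_nonneg_le_one (hp : ∀ i, 0 < p i) (hsum : ∑ i, p i = 1) (i : Fin k) :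
    0 ≤ limitLocation p i ∧ limitLocation p i ≤ 1 := by
  by_cases h0 : (i : ℕ) = 0
  · simp [limitLocation, h0]
  by_cases h1 : (i : ℕ) + 1 = k
  · simp [limitLocation, h0, h1]
  have h0' : 0 < (i : ℕ) := by omega
  have h1' : (i : ℕ) + 1 < k := by have := i.2; omega
  have h := limitLocation_mem hp hsum h0' h1'
  exact ⟨(cumLT_pos hp h0').le.trans h.1.le, h.2.le.trans (cumLE_lt_one hp hsum h1').le⟩

theorem eventually_lt_slotValue_limitLocation (hk : 2 ≤ k) (hp : ∀ i, 0 < p i)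
    (hsum : ∑ i, p i = 1) (hx : StrictMono x) (i : Fin k) {ε : ℝ} (hε : 0 < ε) :
    ∃ N₀ : ℕ, ∀ N, N₀ ≤ N → ∀ n : ℕ, n ≤ N → (limitLocation p i + ε) * N ≤ n →
      x i < slotValue p x (x ⟨0, by omega⟩) (x ⟨k - 1, by omega⟩) N n := by
  have hk0 : 0 < k := by omega
  have hlast : ∀ j : Fin k, j ≤ ⟨k - 1, by omega⟩ := fun j => by
    rw [Fin.le_def]
    have := j.2
    dsimp only
    omega
  have hfirst : ∀ j : Fin k, ⟨0, by omega⟩ ≤ j := fun j => by simp [Fin.le_def]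
  by_cases h0 : (i : ℕ) = 0
  · obtain rfl : i = ⟨0, hk0⟩ := Fin.ext h0
    have hlt : x ⟨0, by omega⟩ < x ⟨k - 1, by omega⟩ := hx (by rw [Fin.lt_def]; dsimp only; omega)
    refine ⟨1, fun N hN n _ hn => ?_⟩
    have hN' : (1 : ℝ) ≤ N := by exact_mod_cast hN
    simp only [limitLocation, if_true, zero_add] at hn
    have hn' : (0 : ℝ) < n := lt_of_lt_of_le (by positivity) hn
    have hn'' : 0 < n := by exact_mod_cast hn'
    obtain ⟨m, rfl⟩ : ∃ m, n = m + 1 := ⟨n - 1, by omega⟩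
    exact lt_slotValue_of_first hp hsum hlt hlt N m
  by_cases h1 : (i : ℕ) + 1 = k
  · refine ⟨1, fun N hN n hnN hn => ?_⟩
    have hN' : (1 : ℝ) ≤ N := by exact_mod_cast hN
    have hnN' : (n : ℝ) ≤ N := by exact_mod_cast hnN
    simp only [limitLocation, h0, h1, if_true, if_false] at hn
    nlinarith
  have h0' : 0 < (i : ℕ) := by omega
  have h1' : (i : ℕ) + 1 < k := by have := i.2; omega
  obtain ⟨N₀, hN₀⟩ := eventually_lt_slotValue hp hsum hx (fun j => hx.monotone (hfirst j))
    (fun j => hx.monotone (hlast j)) h0' h1' (lam := limitLocation p i + ε) (by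
      rw [← rateGap_limitLocation hp hsum h0' h1']
      exact rateGap_strictMono (cumLT_pos hp h0') (cumLT_lt_cumLE hp i) (cumLE_lt_one hp hsum h1')
        (by linarith))
  exact ⟨N₀, fun N hN n _ hn => hN₀ N hN n hn⟩

theorem eventually_slotValue_limitLocation_lt (hk : 2 ≤ k) (hp : ∀ i, 0 < p i)
    (hsum : ∑ i, p i = 1) (hx : StrictMono x) (i : Fin k) {ε : ℝ} (hε : 0 < ε) :
    ∃ N₀ : ℕ, ∀ N, N₀ ≤ N → ∀ n : ℕ, n ≤ N → n ≤ (limitLocation p i - ε) * N →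
      slotValue p x (x ⟨0, by omega⟩) (x ⟨k - 1, by omega⟩) N n < x i := by
  have hkl : k - 1 < k := by omega
  have hlast : ∀ j : Fin k, j ≤ ⟨k - 1, by omega⟩ := fun j => by
    rw [Fin.le_def]
    have := j.2
    dsimp only
    omega
  have hfirst : ∀ j : Fin k, ⟨0, by omega⟩ ≤ j := fun j => by simp [Fin.le_def]
  by_cases h0 : (i : ℕ) = 0
  · refine ⟨1, fun N hN n _ hn => ?_⟩
    have hN' : (1 : ℝ) ≤ N := by exact_mod_cast hN
    have hn' : (0 : ℝ) ≤ n := Nat.cast_nonneg n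
    simp only [limitLocation, h0, if_true] at hn
    nlinarith
  by_cases h1 : (i : ℕ) + 1 = k
  · obtain rfl : i = ⟨k - 1, hkl⟩ := Fin.ext (by dsimp only; omega)
    have hlt : x ⟨0, by omega⟩ < x ⟨k - 1, by omega⟩ := hx (by rw [Fin.lt_def]; dsimp only; omega)
    exact ⟨0, fun N _ n hn _ => slotValue_lt_of_last hp hsum hlt hlt hn⟩
  have h0' : 0 < (i : ℕ) := by omega
  have h1' : (i : ℕ) + 1 < k := by have := i.2; omega
  exact eventually_slotValue_lt hp hsum hx (fun j => hx.monotone (hfirst j))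
    (fun j => hx.monotone (hlast j)) h0' h1' (lam := limitLocation p i - ε) (by
      rw [← rateGap_limitLocation hp hsum h0' h1']
      exact rateGap_strictMono (cumLT_pos hp h0') (cumLT_lt_cumLE hp i) (cumLE_lt_one hp hsum h1')
        (by linarith))

/-- The positions that an optimal policy may choose for `z` when `N` locations are empty. -/
def optimalPositions (p x : Fin k → ℝ) (lo hi z : ℝ) (N : ℕ) : Set ℕ :=
  {l | 0 < l ∧ l ≤ N ∧ slotValue p x lo hi (N - 1) (l - 1) ≤ z ∧
    z ≤ slotValue p x lo hi (N - 1) l}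

theorem eventually_abs_optimalPosition_le (hk : 2 ≤ k) (hp : ∀ i, 0 < p i)
    (hsum : ∑ i, p i = 1) (hx : StrictMono x) (i : Fin k) {ε : ℝ} (hε : 0 < ε) :
    ∀ᶠ N : ℕ in atTop, ∀ l ∈ optimalPositions p x (x ⟨0, by omega⟩) (x ⟨k - 1, by omega⟩) (x i) N,
      |(l : ℝ) - N * limitLocation p i| ≤ N * ε := by
  obtain ⟨N₁, hN₁⟩ := eventually_lt_slotValue_limitLocation hk hp hsum hx i (half_pos hε)
  obtain ⟨N₂, hN₂⟩ := eventually_slotValue_limitLocation_lt hk hp hsum hx i (half_pos hε)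
  obtain ⟨hd0, hd1⟩ := limitLocation_nonneg_le_one hp hsum i
  -- The remaining half of the error, Nε/2 ≥ 1, absorbs the shifts by one between N and N - 1 and
  -- between l and l - 1.
  obtain ⟨N₃, hN₃⟩ := exists_nat_ge (2 / ε)
  rw [div_le_iff₀ hε] at hN₃
  filter_upwards [eventually_ge_atTop (max (N₁ + 1) (max (N₂ + 1) N₃))] with N hN l hl
  obtain ⟨hl0, hlN, hl1, hl2⟩ := hl
  have h1 : N₁ + 1 ≤ N := (le_max_left _ _).trans hN
  have h2 : N₂ + 1 ≤ N := (le_max_left _ _).trans ((le_max_right _ _).trans hN)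
  have h3 : (N₃ : ℝ) ≤ N := by exact_mod_cast (le_max_right _ _).trans ((le_max_right _ _).trans hN)
  obtain ⟨m, rfl⟩ : ∃ m, N = m + 1 := ⟨N - 1, by omega⟩
  obtain ⟨n, rfl⟩ : ∃ n, l = n + 1 := ⟨l - 1, by omega⟩
  rw [Nat.add_sub_cancel] at hl2
  rw [Nat.add_sub_cancel, Nat.add_sub_cancel] at hl1
  have hub : (n : ℝ) < (limitLocation p i + ε / 2) * m := by
    by_contra hcon
    exact absurd (hN₁ m (by omega) n (by omega) (not_lt.1 hcon)) (not_lt.2 hl1)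
  have hlb : (limitLocation p i - ε / 2) * m - 1 ≤ n := by
    rcases Nat.lt_or_ge n m with hnm | hnm
    · by_contra hcon
      refine absurd (hN₂ m (by omega) (n + 1) (by omega) ?_) (not_lt.2 hl2)
      push_cast
      linarith
    -- The topmost position is l = N, whose slot value is the boundary value; here the lower bound
    -- follows from d_i ≤ 1.
    · have h4 : (m : ℝ) ≤ n := by exact_mod_cast hnm
      nlinarith [(Nat.cast_nonneg m : (0 : ℝ) ≤ m)]
  have h4 : 2 ≤ ε * ((m + 1 : ℕ) : ℝ) := by nlinarith
  push_cast at h4 ⊢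
  rw [abs_le]
  constructor <;> nlinarith

/-- The positions of optimal policies follow `limitLocation` up to a vanishing error. -/
theorem exists_tendsto_optimalPosition (hk : 2 ≤ k) (hp : ∀ i, 0 < p i)
    (hsum : ∑ i, p i = 1) (hx : StrictMono x) (i : Fin k) :
    ∃ η : ℕ → ℝ, Tendsto η atTop (𝓝 0) ∧ ∀ N,
      ∀ l ∈ optimalPositions p x (x ⟨0, by omega⟩) (x ⟨k - 1, by omega⟩) (x i) N,
        |(l : ℝ) - N * limitLocation p i| ≤ N * η N := by
  classical
  let S : ℕ → Finset ℕ := fun N => (Finset.range (N + 1)).filter fun l =>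
    l ∈ optimalPositions p x (x ⟨0, by omega⟩) (x ⟨k - 1, by omega⟩) (x i) N
  -- The worst relative error over all admissible positions involves only p, x and i, hence is
  -- uniform in M, the rewards and the policy.
  let η : ℕ → NNReal := fun N => (S N).sup fun l => ‖((l : ℝ) - N * limitLocation p i) / N‖₊
  refine ⟨fun N => η N, ?_, fun N l hl => ?_⟩
  · rw [Metric.tendsto_atTop']
    intro ε hε
    obtain ⟨N₀, hN₀⟩ := eventually_atTop.1
      (eventually_abs_optimalPosition_le hk hp hsum hx i (half_pos hε))
    refine ⟨N₀, fun N hN => ?_⟩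
    have hNp : (0 : ℝ) < N := by exact_mod_cast (by omega : 0 < N)
    have h1 : η N ≤ Real.toNNReal (ε / 2) := Finset.sup_le fun l hl => by
      have h2 := hN₀ N (by omega) l (Finset.mem_filter.1 hl).2
      rw [Real.le_toNNReal_iff_coe_le (by positivity), coe_nnnorm, norm_div, Real.norm_eq_abs,
        Real.norm_of_nonneg hNp.le, div_le_iff₀ hNp]
      linarith
    have h2 : (η N : ℝ) ≤ ε / 2 := (Real.le_toNNReal_iff_coe_le (by positivity)).1 h1
    rw [Real.dist_0_eq_abs, NNReal.abs_eq]
    exact lt_of_le_of_lt h2 (by linarith)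
  · have hNp : (0 : ℝ) < N := by exact_mod_cast hl.1.trans_le hl.2.1
    have h1 : ‖((l : ℝ) - N * limitLocation p i) / N‖₊ ≤ η N :=
      Finset.le_sup (f := fun l : ℕ => ‖((l : ℝ) - N * limitLocation p i) / N‖₊)
        (Finset.mem_filter.2 ⟨Finset.mem_range.2 (Nat.lt_succ_of_le hl.2.1), hl⟩)
    have h2 : ‖((l : ℝ) - N * limitLocation p i) / N‖ ≤ η N := by exact_mod_cast h1
    rw [norm_div, Real.norm_eq_abs, Real.norm_of_nonneg hNp.le, div_le_iff₀ hNp] at h2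
    linarith

end Asymptotics

end SeqAssign

theorem theorem2 {k : ℕ} (hk : 3 ≤ k) (p x : Fin k → ℝ) (hp : ∀ i, 0 < p i)
    (hsum : ∑ i, p i = 1) (hx : StrictMono x) :
    -- asymptotics of the position chosen by any optimal policy with `N` locations left
    (∀ i : Fin k, ∃ η : ℕ → ℝ, Tendsto η atTop (𝓝 0) ∧
      ∀ (N M : ℕ) (t : Fin M), M = (t : ℕ) + N →
      ∀ (Ω : Type*) [MeasurableSpace Ω] (P : Measure Ω) [IsProbabilityMeasure P]
        (X : Fin M → Ω → ℝ), SeqAssign.IsIIDSample p x X P →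
      ∀ r : Fin M → ℝ, StrictMono r →
      ∀ J : Fin M → Ω → Fin M, SeqAssign.IsOptimal P X r J →
      ∀ᵐ ω ∂P, X t ω = x i →
        |(SeqAssign.chosenPosition J t ω : ℝ) - N * SeqAssign.limitLocation p i| ≤ N * η N) ∧
    -- for the interior indices, the limit is the point where two large-deviation rates agree
    (∀ i : Fin k, 0 < (i : ℕ) → (i : ℕ) + 1 < k →
      (∀ y ∈ Set.Ioo (SeqAssign.cumLT p i) (SeqAssign.cumLE p i),
        ∀ (Ω : Type*) [MeasurableSpace Ω] (P : Measure Ω) [IsProbabilityMeasure P]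
          (X : ℕ → Ω → ℝ), SeqAssign.IsIIDSample p x X P →
        Tendsto (fun N : ℕ => -(1 / (N : ℝ) *
            Real.log (P.real {ω | y * N ≤ (#{t ∈ range N | X t ω < x i} : ℝ)})))
          atTop (𝓝 (SeqAssign.binomialRate (SeqAssign.cumLT p i) y)) ∧
        Tendsto (fun N : ℕ => -(1 / (N : ℝ) *
            Real.log (P.real {ω | (1 - y) * N ≤ (#{t ∈ range N | x i < X t ω} : ℝ)})))
          atTop (𝓝 (SeqAssign.binomialRate (SeqAssign.cumLE p i) y))) ∧
      SeqAssign.limitLocation p i ∈ Set.Ioo (SeqAssign.cumLT p i) (SeqAssign.cumLE p i) ∧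
      ∀ y ∈ Set.Ioo (SeqAssign.cumLT p i) (SeqAssign.cumLE p i),
        (SeqAssign.binomialRate (SeqAssign.cumLT p i) y =
          SeqAssign.binomialRate (SeqAssign.cumLE p i) y ↔
            y = SeqAssign.limitLocation p i)) := by
  refine ⟨fun i => ?_, fun i hi0 hik => ⟨fun y hy Ω _ P _ X hX => ⟨?_, ?_⟩,
    SeqAssign.limitLocation_mem hp hsum hi0 hik,
    fun y _ => SeqAssign.binomialRate_eq_iff hp hsum hi0 hik y⟩⟩
  · obtain ⟨η, hη, h⟩ := SeqAssign.exists_tendsto_optimalPosition (by omega) hp hsum hx i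
    refine ⟨η, hη, ?_⟩
    rintro N M t hM Ω _ P _ X hX r hr J hJ
    have hlo : ∀ j : Fin k, x ⟨0, by omega⟩ ≤ x j := fun j => hx.monotone (by simp [Fin.le_def])
    have hhi : ∀ j : Fin k, x j ≤ x ⟨k - 1, by omega⟩ := fun j => hx.monotone (by
      rw [Fin.le_def]
      have := j.2
      dsimp only
      omega)
    filter_upwards [hJ.slotValue_le hp hsum hx hlo hhi hr hX t] with ω hω hxi
    obtain ⟨h0, h1⟩ := hJ.1.chosenPosition_mem t ω
    have hN : M - (t : ℕ) = N := by omega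
    rw [hN, hxi] at hω
    exact h N _ ⟨h0, hN ▸ h1, hω⟩
  · refine hX.tendsto_log_tail hp (s := fun z => z < x i) measurableSet_Iio ?_
      (SeqAssign.cumLT_pos hp hi0) hy.1 (hy.2.trans (SeqAssign.cumLE_lt_one hp hsum hik))
    simp only [hx.lt_iff_lt]
    rfl
  -- Observations above x_i have probability 1 - f_i, and 1 - y exceeds it, so this too is an upper
  -- tail; complementing both arguments leaves the rate unchanged.
  · rw [← SeqAssign.binomialRate_compl]
    refine hX.tendsto_log_tail hp (s := fun z => x i < z) measurableSet_Ioi ?_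
      (by linarith [SeqAssign.cumLE_lt_one hp hsum hik]) (by linarith [hy.2])
      (by linarith [hy.1, SeqAssign.cumLT_pos hp hi0])
    simp only [hx.lt_iff_lt]
    exact SeqAssign.cumLE_compl hsum i
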